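/- Fix parameters $\sigma_1>0$, $\sigma_2\ge 0$, $\lambda\ge 0$, $\delta,\kappa,\rho>0$ and a cost function $c:[0,\infty)\to[0,\infty)$ that is strictly convex, strictly increasing and twice continuously differentiable (one-sidedly at $0$). Put $$f(\gamma,h)=-(\sigma_1^{-2}+h)\gamma^2-2\lambda\gamma+\sigma_2^2,\qquad \gamma^0_\infty=-\lambda\sigma_1^2+\sqrt{\lambda^2\sigma_1^4+\sigma_1^2\sigma_2^2},$$ $$a_1=\tfrac14\bigl(\sqrt{\delta^2\rho^2+4\kappa\rho}-\delta\rho\bigr),\qquad a_3=\frac{2a_1\rho}{\delta\rho+\lambda\rho+2a_1},\qquad \bar a=\frac{a_3^2}{2\rho},$$ fix $\gamma_{\max}>\gamma^0_\infty$, and let $M_0=\gamma_{\max}^2\bar a/\delta$ and $h_{\max}=(c')^{-1}(M_0)$. Here it is assumed that $c'(x)\ge M_0$ for some $x\ge 0$, and $h_{\max}:=0$ if $M_0<c'(0)$. For $\gamma_0\in[0,\gamma_{\max}]$ and a Borel function $h:[0,\infty)\to[0,h_{\max}]$ let $\gamma^h$ be the absolutely continuous solution of $d\gamma_t=f(\gamma_t,h_t)\,dt$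 with initial value $\gamma_0$, and let $$v(\gamma_0)=\inf_h\int_0^\infty e^{-\delta t}\bigl(\bar a\,\gamma^h_t+c(h_t)\bigr)\,dt .$$ Let $\gamma_{\mathcal D}$ be the number in $[0,\gamma_{\max}]$ with $\gamma_{\mathcal D}^2\,v'(\gamma_{\mathcal D})=c'(0)$ if there is one, and $\gamma_{\mathcal D}=\gamma_{\max}$ otherwise (with one-sided derivatives $v'$ at the end points $0$ and $\gamma_{\max}$). Then for every $\gamma_0\in[0,\gamma_{\max}]$ a continuous optimal rate $h^*$ exists. For each such $h^*$, with optimal conditional variance $\gamma^*=\gamma^{h^*}$, the following holds. (i) $\lim_{t\to\infty}\gamma^*_t=\gamma_{\mathrm{eq}}$ and $\lim_{t\to\infty}h^*_t=h_{\mathrm{eq}}$ for some $\gamma_{\mathrm{eq}}\in[0,\gamma_{\max}]$ and $h_{\mathrm{eq}}\in[0,h_{\max}]$ that do not depend on $\gamma_0$. (ii) With the other data fixed, $\gamma_{\mathrm{eq}}\to 0$ as $\sigma_2\to 0$; moreover $\gamma_{\mathrm{eq}}=0$ if and only if $\sigma_2=0$. (iii) Both $t\mapsto\gamma^*_t$ and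 $t\mapsto h^*_t$ are monotone on $[0,\infty)$. For every $t\ge 0$, $h^*_t=0$ if $\gamma^*_t\le\gamma_{\mathcal D}$, and $h^*_t>0$ if $\gamma^*_t>\gamma_{\mathcal D}$. -/

import Mathlib

open Set Filter MeasureTheory
open scoped Topology

/-- The data of the information acquisition problem: volatilities `σ₁`, `σ₂`, speed of mean
reversion `lam`, discount rate `δ`, cost coefficients `κ`, `ρ`, upper bound `γmax` of the state
space of the conditional variance, and information cost `c` (only its values on `[0, ∞)`
matter). -/
structure Model where
  σ₁ : ℝ
  σ₂ : ℝ
  lam : ℝ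
  δ : ℝ
  κ : ℝ
  ρ : ℝ
  γmax : ℝ
  c : ℝ → ℝ

namespace Model

/-- The marginal information cost `c'` on `[0, ∞)` (one-sided at `0`). -/
noncomputable def c' (M : Model) (x : ℝ) : ℝ := derivWithin M.c (Ici 0) x

/-- The drift `f` of the conditional variance. -/
noncomputable def f (M : Model) (γ h : ℝ) : ℝ :=
  -((1 / M.σ₁) ^ 2 + h) * γ ^ 2 - 2 * M.lam * γ + M.σ₂ ^ 2

/-- The stable equilibrium of the uncontrolled conditional variance. -/
noncomputable def γInf (M : Model) : ℝ :=
  -(M.lam * M.σ₁ ^ 2) + Real.sqrt (M.lam ^ 2 * M.σ₁ ^ 4 + M.σ₁ ^ 2 * M.σ₂ ^ 2)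

noncomputable def a₁ (M : Model) : ℝ :=
  -(M.δ * M.ρ / 4) + Real.sqrt (M.δ ^ 2 * M.ρ ^ 2 + 4 * M.κ * M.ρ) / 4

noncomputable def a₃ (M : Model) : ℝ :=
  2 * M.a₁ * M.ρ / (M.δ * M.ρ + M.lam * M.ρ + 2 * M.a₁)

/-- The weight of the conditional variance in the running cost. -/
noncomputable def abar (M : Model) : ℝ := M.a₃ ^ 2 / (2 * M.ρ)

noncomputable def M₀ (M : Model) : ℝ := M.γmax ^ 2 * (M.abar / M.δ)

/-- The maximal rate `(c')⁻¹ (M₀)`; this generalized inverse has the value `0` if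
`M₀ < c' 0`. -/
noncomputable def hmax (M : Model) : ℝ := sInf {x : ℝ | 0 ≤ x ∧ M.M₀ ≤ M.c' x}

/-- The standing assumptions. The last one says that `(c')⁻¹ (M₀)` is finite. -/
structure Standing (M : Model) : Prop where
  σ₁_pos : 0 < M.σ₁
  σ₂_nonneg : 0 ≤ M.σ₂
  lam_nonneg : 0 ≤ M.lam
  δ_pos : 0 < M.δ
  κ_pos : 0 < M.κ
  ρ_pos : 0 < M.ρ
  γInf_lt : M.γInf < M.γmax
  c_nonneg : ∀ x, 0 ≤ x → 0 ≤ M.c x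
  c_convex : StrictConvexOn ℝ (Ici 0) M.c
  c_smooth : ContDiffOn ℝ 2 M.c (Ici 0)
  c_mono : StrictMonoOn M.c (Ici 0)
  c'_reaches : ∃ x, 0 ≤ x ∧ M.M₀ ≤ M.c' x

/-- Admissible information acquisition rates: Borel functions `[0, ∞) → [0, hmax]`. -/
def Admissible (M : Model) (h : ℝ → ℝ) : Prop :=
  (Measurable fun t : Ici (0 : ℝ) => h t) ∧ ∀ t, 0 ≤ t → h t ∈ Icc 0 M.hmax

/-- `γ` is the (absolutely continuous) solution on `[0, ∞)` of `dγ = f(γ, h) dt`, `γ 0 = γ₀`,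
in integral form. -/
def IsState (M : Model) (γ₀ : ℝ) (h γ : ℝ → ℝ) : Prop :=
  ContinuousOn γ (Ici 0) ∧ ∀ t, 0 ≤ t → γ t = γ₀ + ∫ s in (0 : ℝ)..t, M.f (γ s) (h s)

/-- The discounted cost of the rate `h` with controlled state `γ`. -/
noncomputable def cost (M : Model) (h γ : ℝ → ℝ) : ℝ :=
  ∫ t in Ioi (0 : ℝ), Real.exp (-M.δ * t) * (M.abar * γ t + M.c (h t))

/-- The value function `v` of the reduced problem. -/
noncomputable def value (M : Model) (γ₀ : ℝ) : ℝ :=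
  sInf {J : ℝ | ∃ h γ : ℝ → ℝ, M.Admissible h ∧ M.IsState γ₀ h γ ∧ J = M.cost h γ}

/-- `h` is a continuous optimal rate for the initial variance `γ₀`, and `γ` is the associated
optimal conditional variance. -/
structure IsOptimal (M : Model) (γ₀ : ℝ) (h γ : ℝ → ℝ) : Prop where
  admissible : M.Admissible h
  continuousOn : ContinuousOn h (Ici 0)
  state : M.IsState γ₀ h γ
  optimal : M.cost h γ = M.value γ₀

/-- The derivative `v'` on `[0, γmax]`, one-sided at the end points. -/
noncomputable def value' (M : Model) (γ : ℝ) : ℝ := derivWithin M.value (Icc 0 M.γmax) γ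

open Classical in
/-- The threshold: the point of `[0, γmax]` where `γ² v'(γ) = c'(0)`, and `γmax` if there is none.
In terms of the precision `x = 1 / γ` and `w x = v (1 / x)`, one has `γ² v'(γ) = -w'(x)`. -/
noncomputable def γD (M : Model) : ℝ :=
  if hD : ∃ γ, γ ∈ Icc 0 M.γmax ∧ γ ^ 2 * M.value' γ = M.c' 0 then hD.choose else M.γmax

end Model

/-! In the precision `x = 1 / γ` the problem is convex. The drift of `x` is `σ₁⁻² + h + 2 λ x - σ₂²
x²`, concave in `x` and linear in `h`, and the running cost `abar / x + c h` is convex. Since the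
shadow price of precision is nonnegative, the first order conditions are therefore sufficient for
optimality. They form an autonomous system for the state `γ` and a bounded costate `q`, with `h =
rate (γ ^ 2 * q)`; its solutions are the extremals of `IsExtremal`.

Existence (`exists_isExtremal`): `rate` is only continuous, so it is replaced by polynomials. The
smoothed system is solved on `[0, n]` by shooting for terminal costate `0`, and compactness of `box`
gives a limit on `[0, ∞)`.

Verification (`cost_add_integral_excess_le`): the cost of any rate exceeds that of an extremal by at
least a boundary term plus the integral of a nonnegative `excess`. For equal initial states the
boundary term vanishes, so extremals are optimal. The vanishing of the excess makes the continuous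
optimal rate unique, and then the bounded costate is unique too. For different initial states the
inequality says that `x ↦ v (1 / x)` has strict subgradients.

Qualitative behaviour: by uniqueness the costate is a function of the state (`costate`), continuous
by compactness and equal to `v'` for positive states. Extremals do not cross, and for an autonomous
system this makes every optimal state monotone, hence convergent to an equilibrium of the feedback
system. Convexity in the precision makes `price x = x ^ 2 * costate x` increasing. So the optimal
rate is a nondecreasing function of the state, which gives the threshold and the monotonicity of the
rate; it also makes the feedback drift strictly decreasing, so there is only one equilibrium. The
equilibrium is at most `σ₁ σ₂`, while the drift at `0` is `σ₂²`, whence (ii). -/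

namespace Model

/-! ### The marginal cost and its generalized inverse -/

variable {M : Model}

/-- The optimal rate at shadow price `p` of the precision: the generalized inverse of the marginal
cost `c'`. -/
noncomputable def rate (M : Model) (p : ℝ) : ℝ := sInf {x : ℝ | 0 ≤ x ∧ p ≤ M.c' x}

namespace Standing

lemma c'_continuousOn (hM : M.Standing) : ContinuousOn M.c' (Ici 0) :=
  hM.c_smooth.continuousOn_derivWithin (uniqueDiffOn_Ici 0) (by norm_num)

lemma c_differentiableOn (hM : M.Standing) : DifferentiableOn ℝ M.c (Ici 0) :=
  hM.c_smooth.differentiableOn (by norm_num)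

lemma c'_strictMonoOn (hM : M.Standing) : StrictMonoOn M.c' (Ici 0) :=
  hM.c_convex.strictMonoOn_derivWithin hM.c_differentiableOn

lemma c'_nonneg (hM : M.Standing) (x : ℝ) : 0 ≤ M.c' x :=
  hM.c_mono.monotoneOn.derivWithin_nonneg

/-- The tangent inequality for the strictly convex information cost. -/
lemma c_tangent (hM : M.Standing) {x y : ℝ} (hx : 0 ≤ x) (hy : 0 ≤ y) (hxy : x ≠ y) :
    M.c x + M.c' x * (y - x) < M.c y := by
  rcases lt_or_gt_of_ne hxy with h | h
  · have := hM.c_convex.derivWithin_lt_slope hx hy h (hM.c_differentiableOn x hx)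
    rw [slope_def_field, lt_div_iff₀ (by linarith)] at this
    unfold Model.c'
    linarith
  · have := hM.c_convex.slope_lt_derivWithin hy hx h (hM.c_differentiableOn x hx)
    rw [slope_def_field, div_lt_iff₀ (by linarith)] at this
    unfold Model.c'
    linarith

lemma γmax_pos (hM : M.Standing) : 0 < M.γmax := by
  refine lt_of_le_of_lt ?_ hM.γInf_lt
  unfold γInf
  have h : M.lam * M.σ₁ ^ 2 ≤ Real.sqrt (M.lam ^ 2 * M.σ₁ ^ 4 + M.σ₁ ^ 2 * M.σ₂ ^ 2) := by
    apply Real.le_sqrt_of_sq_le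
    nlinarith [mul_nonneg (sq_nonneg M.σ₁) (sq_nonneg M.σ₂)]
  linarith

lemma abar_pos (hM : M.Standing) : 0 < M.abar := by
  have := hM.δ_pos
  have := hM.κ_pos
  have := hM.ρ_pos
  have := hM.lam_nonneg
  have h1 : 0 < M.a₁ := by
    unfold a₁
    have : M.δ * M.ρ < Real.sqrt (M.δ ^ 2 * M.ρ ^ 2 + 4 * M.κ * M.ρ) := by
      apply Real.lt_sqrt_of_sq_lt
      have : 0 < M.κ * M.ρ := by positivity
      nlinarith
    linarith
  unfold abar a₃
  positivity

lemma M₀_pos (hM : M.Standing) : 0 < M.M₀ := by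
  have := hM.abar_pos
  have := hM.δ_pos
  have := hM.γmax_pos
  unfold M₀
  positivity

/-- Continuity of `c'` closes the set, and `c'_reaches` makes it nonempty for prices up to `M₀`. No
larger price occurs on `box`. -/
lemma isLeast_rate (hM : M.Standing) {p : ℝ} (hp : p ≤ M.M₀) :
    IsLeast {x : ℝ | 0 ≤ x ∧ p ≤ M.c' x} (M.rate p) := by
  have hclosed : IsClosed {x : ℝ | 0 ≤ x ∧ p ≤ M.c' x} := by
    have := hM.c'_continuousOn.preimage_isClosed_of_isClosed isClosed_Ici (isClosed_Ici (a := p))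
    exact this
  obtain ⟨x, hx, hx'⟩ := hM.c'_reaches
  exact hclosed.isLeast_csInf ⟨x, hx, hp.trans hx'⟩ ⟨0, fun y hy => hy.1⟩

lemma rate_nonneg (M : Model) (p : ℝ) : 0 ≤ M.rate p := Real.sInf_nonneg fun _ h => h.1

lemma le_c'_rate (hM : M.Standing) {p : ℝ} (hp : p ≤ M.M₀) : p ≤ M.c' (M.rate p) :=
  (hM.isLeast_rate hp).1.2

lemma rate_le (hM : M.Standing) {p x : ℝ} (hp : p ≤ M.M₀) (hx : 0 ≤ x) (hpx : p ≤ M.c' x) :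
    M.rate p ≤ x := (hM.isLeast_rate hp).2 ⟨hx, hpx⟩

lemma monotoneOn_rate (hM : M.Standing) : MonotoneOn M.rate (Iic M.M₀) := fun _ hp _ hq hpq =>
  hM.rate_le hp (rate_nonneg M _) (hpq.trans (hM.le_c'_rate hq))

lemma rate_le_hmax (hM : M.Standing) {p : ℝ} (hp : p ≤ M.M₀) : M.rate p ≤ M.hmax :=
  hM.monotoneOn_rate hp (le_refl M.M₀) hp

lemma hmax_nonneg (M : Model) : 0 ≤ M.hmax := rate_nonneg M M.M₀

/-- If `c'` were larger than `p` at a positive `rate p`, continuity would produce a smaller point of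
the defining set. At `rate p = 0` only the inequality `p ≤ c' 0` remains. -/
lemma c'_rate (hM : M.Standing) {p : ℝ} (hp : p ≤ M.M₀) (h0 : 0 < M.rate p) :
    M.c' (M.rate p) = p := by
  refine le_antisymm ?_ (hM.le_c'_rate hp)
  by_contra! h
  have hc : ContinuousWithinAt M.c' (Ici 0) (M.rate p) := hM.c'_continuousOn _ h0.le
  have h1 : ∀ᶠ x in 𝓝 (M.rate p), p < M.c' x :=
    (hc.continuousAt (Ici_mem_nhds h0)).eventually (lt_mem_nhds h)
  have h2 : ∀ᶠ x in 𝓝[<] (M.rate p), p < M.c' x ∧ 0 < x ∧ x < M.rate p :=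
    (h1.filter_mono nhdsWithin_le_nhds).and
      (((lt_mem_nhds h0).filter_mono nhdsWithin_le_nhds).and self_mem_nhdsWithin)
  obtain ⟨x, hx1, hx2, hx3⟩ := h2.exists
  exact absurd (hM.rate_le hp hx2.le hx1.le) (not_le.2 hx3)

lemma rate_eq_zero (hM : M.Standing) {p : ℝ} (hp : p ≤ M.M₀) (h : p ≤ M.c' 0) : M.rate p = 0 :=
  le_antisymm (hM.rate_le hp le_rfl h) (rate_nonneg M p)

lemma rate_pos (hM : M.Standing) {p : ℝ} (hp : p ≤ M.M₀) (h : M.c' 0 < p) : 0 < M.rate p := by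
  refine lt_of_le_of_ne (rate_nonneg M p) fun h0 => ?_
  have := hM.le_c'_rate hp
  rw [← h0] at this
  linarith

/-- Strict monotonicity of `c'` excludes jumps of the inverse. Nothing better than continuity is
available, since `c''` may vanish. -/
lemma continuousOn_rate (hM : M.Standing) : ContinuousOn M.rate (Iic M.M₀) := by
  intro p hp
  rw [Metric.continuousWithinAt_iff']
  intro ε hε
  have h0 := rate_nonneg M p
  have up : ∀ᶠ p' in 𝓝[Iic M.M₀] p, M.rate p' ≤ M.rate p + ε / 2 := by
    have h1 : p < M.c' (M.rate p + ε / 2) := (hM.le_c'_rate hp).trans_lt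
      (hM.c'_strictMonoOn h0 (show (0:ℝ) ≤ _ by linarith) (by linarith))
    filter_upwards [(gt_mem_nhds h1).filter_mono nhdsWithin_le_nhds, self_mem_nhdsWithin]
      with p' h2 h3
    exact hM.rate_le h3 (by linarith) h2.le
  have low : ∀ᶠ p' in 𝓝[Iic M.M₀] p, M.rate p - ε / 2 ≤ M.rate p' := by
    by_cases hx : M.rate p ≤ ε / 2
    · exact Eventually.of_forall fun p' => by linarith [rate_nonneg M p']
    push Not at hx
    have h1 : M.c' (M.rate p - ε / 2) < p := by
      rw [← hM.c'_rate hp (by linarith)]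
      have := hM.c'_strictMonoOn (show (0:ℝ) ≤ M.rate p - ε / 2 by linarith)
        h0 (show M.rate p - ε / 2 < M.rate p by linarith)
      rwa [hM.c'_rate hp (by linarith)] at this ⊢
    filter_upwards [(lt_mem_nhds h1).filter_mono nhdsWithin_le_nhds, self_mem_nhdsWithin]
      with p' h2 h3
    by_contra! h4
    have := hM.c'_strictMonoOn (rate_nonneg M p') (show (0:ℝ) ≤ M.rate p - ε / 2 by linarith) h4
    linarith [hM.le_c'_rate h3]
  filter_upwards [up, low] with p' h1 h2
  rw [Real.dist_eq, abs_lt]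
  constructor <;> linarith

/-- The maximum principle: `rate p` is the only minimizer of `c h - p * h` over `h ≥ 0`. This is the
tangent inequality with complementary slackness: either `c' (rate p) = p`, or `rate p = 0` and `p ≤
c' 0`. -/
lemma cost_gap_pos (hM : M.Standing) {p h : ℝ} (hp : p ≤ M.M₀) (hh : 0 ≤ h)
    (hne : h ≠ M.rate p) : 0 < M.c h - M.c (M.rate p) - p * (h - M.rate p) := by
  have h1 := hM.c_tangent (rate_nonneg M p) hh hne.symm
  have h2 : p * (h - M.rate p) ≤ M.c' (M.rate p) * (h - M.rate p) := by
    rcases (rate_nonneg M p).eq_or_lt with h0 | h0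
    · exact mul_le_mul_of_nonneg_right (hM.le_c'_rate hp) (by linarith)
    · rw [hM.c'_rate hp h0]
  linarith

lemma cost_gap_nonneg (hM : M.Standing) {p h : ℝ} (hp : p ≤ M.M₀) (hh : 0 ≤ h) :
    0 ≤ M.c h - M.c (M.rate p) - p * (h - M.rate p) := by
  by_cases hne : h = M.rate p
  · simp [hne]
  · exact (hM.cost_gap_pos hp hh hne).le

end Standing

end Model

/-! ### Sign preservation and limits of solutions of differential equations -/

/-- A function whose derivative is nonnegative wherever the function is negative stays
nonnegative. -/
lemma nonneg_of_hasDerivWithinAt {u u' : ℝ → ℝ} {a b : ℝ}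
    (hu : ∀ t ∈ Icc a b, HasDerivWithinAt u (u' t) (Icc a b) t) (ha : 0 ≤ u a)
    (hu' : ∀ t ∈ Icc a b, u t < 0 → 0 ≤ u' t) : ∀ t ∈ Icc a b, 0 ≤ u t := by
  intro t ht
  by_contra! hneg
  have hc : ContinuousOn u (Icc a b) := fun s hs => (hu s hs).continuousWithinAt
  have hct : ContinuousOn u (Icc a t) := hc.mono (Icc_subset_Icc_right ht.2)
  have hcomp : IsCompact (Icc a t ∩ u ⁻¹' Ici 0) :=
    isCompact_Icc.of_isClosed_subset (hct.preimage_isClosed_of_isClosed isClosed_Icc isClosed_Ici)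
      inter_subset_left
  -- Let `s` be the last time up to `t` with `u ≥ 0`. After it `u` is negative, hence nondecreasing,
  -- so `u t` cannot drop below `u s`.
  obtain ⟨s, ⟨hs, hs0⟩, hmax⟩ := hcomp.exists_isGreatest ⟨a, ⟨le_rfl, ht.1⟩, ha⟩
  have hneg' : ∀ r ∈ Ioc s t, u r < 0 := by
    intro r hr
    by_contra! h
    exact absurd (hmax ⟨⟨hs.1.trans hr.1.le, hr.2⟩, h⟩) (not_le.2 hr.1)
  have hd : ∀ r ∈ interior (Icc s t), HasDerivWithinAt u (u' r) (interior (Icc s t)) r := by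
    intro r hr
    refine (hu r ?_).mono ?_
    · have := interior_subset hr
      exact ⟨hs.1.trans this.1, this.2.trans ht.2⟩
    · exact interior_subset.trans (Icc_subset_Icc hs.1 ht.2)
  have hmono : MonotoneOn u (Icc s t) := by
    refine monotoneOn_of_hasDerivWithinAt_nonneg (convex_Icc s t)
      (hc.mono (Icc_subset_Icc hs.1 ht.2)) hd fun r hr => ?_
    rw [interior_Icc] at hr
    exact hu' r ⟨hs.1.trans hr.1.le, hr.2.le.trans ht.2⟩ (hneg' r ⟨hr.1, hr.2.le⟩)
  have := hmono (left_mem_Icc.2 hs.2) (right_mem_Icc.2 hs.2) hs.2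
  exact absurd (le_trans hs0 this) (not_le.2 hneg)

/-- The backward version of `nonneg_of_hasDerivWithinAt`. -/
lemma nonneg_of_hasDerivWithinAt_right {u u' : ℝ → ℝ} {a b : ℝ}
    (hu : ∀ t ∈ Icc a b, HasDerivWithinAt u (u' t) (Icc a b) t) (hb : 0 ≤ u b)
    (hu' : ∀ t ∈ Icc a b, u t < 0 → u' t ≤ 0) : ∀ t ∈ Icc a b, 0 ≤ u t := by
  have hmem : ∀ {t}, t ∈ Icc a b → a + b - t ∈ Icc a b := fun ht =>
    ⟨by linarith [ht.2], by linarith [ht.1]⟩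
  have key := nonneg_of_hasDerivWithinAt (u := fun t => u (a + b - t))
    (u' := fun t => -u' (a + b - t)) (a := a) (b := b) ?_ (by simpa using hb) ?_
  · intro t ht
    simpa using key _ (hmem ht)
  · intro t ht
    have h1 : HasDerivWithinAt (fun t => a + b - t) (-1) (Icc a b) t :=
      (hasDerivWithinAt_id t _).const_sub (a + b)
    have := (hu _ (hmem ht)).scomp t h1 (fun s hs => hmem hs)
    simpa [Function.comp_def] using this
  · intro t ht hlt
    simpa using hu' _ (hmem ht) hlt

/-- Solutions of ordinary differential equations on intervals exhausting `[0, ∞)` with values in a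
compact set, whose vector fields converge uniformly to a continuous one, accumulate at a solution
of the limit equation on `[0, ∞)`. -/
lemma exists_limit_solution {E : Type*} [NormedAddCommGroup E] [NormedSpace ℝ E] {K : Set E}
    (hK : IsCompact K) {G : E → E} (hG : ContinuousOn G K) {Gn : ℕ → E → E}
    (hGn : TendstoUniformlyOn Gn G atTop K) {y : ℕ → ℝ → E} {T : ℕ → ℝ}
    (hT : Tendsto T atTop atTop)
    (hyK : ∀ n, ∀ t ∈ Icc 0 (T n), y n t ∈ K)
    (hy : ∀ n, ∀ t ∈ Icc 0 (T n), HasDerivWithinAt (y n) (Gn n (y n t)) (Icc 0 (T n)) t) :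
    ∃ z : ℝ → E, (∀ t, 0 ≤ t → z t ∈ K ∧ HasDerivWithinAt z (G (z t)) (Ici 0) t) ∧
      ∃ U : Ultrafilter ℕ, (U : Filter ℕ) ≤ atTop ∧
        Tendsto (fun n => y n 0) U (𝓝 (z 0)) := by
  -- Along one ultrafilter all values `y n t` converge by compactness, simultaneously in `t`; no
  -- diagonal subsequence is needed.
  set U : Ultrafilter ℕ := hyperfilter ℕ
  have hU : (U : Filter ℕ) ≤ atTop := Nat.hyperfilter_le_atTop
  have hev : ∀ t, ∀ᶠ n in U, t ≤ T n := fun t => hU (hT.eventually_ge_atTop t)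
  have hex : ∀ t, ∃ w, 0 ≤ t → w ∈ K ∧ Tendsto (fun n => y n t) U (𝓝 w) := by
    intro t
    by_cases ht : 0 ≤ t
    · have : K ∈ U.map (fun n => y n t) := by
        refine Ultrafilter.mem_map.2 ?_
        filter_upwards [hev t] with n hn using hyK n t ⟨ht, hn⟩
      obtain ⟨w, hw, hw'⟩ := hK.ultrafilter_le_nhds' _ this
      exact ⟨w, fun _ => ⟨hw, hw'⟩⟩
    · exact ⟨0, fun h => absurd h ht⟩
  choose z hz using hex
  refine ⟨z, fun s hs => ⟨(hz s hs).1, ?_⟩, U, hU, (hz 0 le_rfl).2⟩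
  obtain ⟨B, hB⟩ := hK.exists_bound_of_continuousOn hG
  have hB' : ∀ᶠ n in U, ∀ w ∈ K, ‖Gn n w‖ ≤ |B| + 1 := by
    filter_upwards [hU (Metric.tendstoUniformlyOn_iff.1 hGn 1 one_pos)] with n hn w hw
    have h1 := hn w hw
    rw [dist_eq_norm] at h1
    have h2 : ‖Gn n w‖ ≤ ‖G w‖ + ‖G w - Gn n w‖ := by
      have := norm_sub_norm_le (Gn n w) (G w)
      rw [norm_sub_rev] at this
      linarith
    linarith [hB w hw, le_abs_self B]
  rw [hasDerivWithinAt_iff_isLittleO, Asymptotics.isLittleO_iff]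
  intro ε hε
  obtain ⟨η, hη, hηG⟩ := Metric.uniformContinuousOn_iff.1 (hK.uniformContinuousOn_of_continuous hG)
    (ε / 2) (by positivity)
  have hnear : ∀ᶠ t in 𝓝[Ici 0] s, 0 ≤ t ∧ (|B| + 1) * |t - s| < η := by
    have h1 : Tendsto (fun t => (|B| + 1) * |t - s|) (𝓝 s) (𝓝 0) := by
      have : Continuous fun t => (|B| + 1) * |t - s| := by fun_prop
      simpa using this.tendsto s
    exact Eventually.and self_mem_nhdsWithin ((h1.eventually (gt_mem_nhds hη)).filter_mono
      nhdsWithin_le_nhds)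
  filter_upwards [hnear] with t ht
  obtain ⟨ht0, htη⟩ := ht
  -- The difference quotient estimate for `y n` holds on a neighbourhood of `s` independent of `n`,
  -- because the fields are uniformly bounded and `G` is uniformly continuous. It therefore survives
  -- the limit along `U`.
  have hn : ∀ᶠ n in U, ‖y n t - y n s - (t - s) • G (y n s)‖ ≤ ε * ‖t - s‖ := by
    filter_upwards [hB', hev t, hev s,
      hU (Metric.tendstoUniformlyOn_iff.1 hGn (ε / 2) (by positivity))] with n h1 h2 h3 h4
    have hlip : ∀ a ∈ Icc 0 (T n), ∀ b ∈ Icc 0 (T n), ‖y n b - y n a‖ ≤ (|B| + 1) * ‖b - a‖ :=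
      fun a ha b hb => (convex_Icc 0 (T n)).norm_image_sub_le_of_norm_hasDerivWithin_le
        (fun r hr => hy n r hr) (fun r hr => h1 _ (hyK n r hr)) ha hb
    have hsub : uIcc s t ⊆ Icc 0 (T n) := by
      intro r hr
      exact ⟨(le_min hs ht0).trans hr.1, hr.2.trans (max_le h3 h2)⟩
    have hsmem : s ∈ Icc 0 (T n) := ⟨hs, h3⟩
    have key := (convex_uIcc s t).norm_image_sub_le_of_norm_hasDerivWithin_le
      (f := fun r => y n r - r • G (y n s)) (f' := fun r => Gn n (y n r) - G (y n s)) (C := ε)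
      (x := s) (y := t) ?_ ?_ left_mem_uIcc right_mem_uIcc
    · have e : y n t - y n s - (t - s) • G (y n s)
          = y n t - t • G (y n s) - (y n s - s • G (y n s)) := by rw [sub_smul]; abel
      rw [e]
      exact key
    · intro r hr
      have h5 := ((hy n r (hsub hr)).mono hsub).sub
        ((hasDerivWithinAt_id r (uIcc s t)).smul_const (G (y n s)))
      rw [one_smul] at h5
      exact h5
    · intro r hr
      have hrK := hyK n r (hsub hr)
      have hsK := hyK n s hsmem
      have h6 : dist (y n r) (y n s) < η := by
        rw [dist_eq_norm]
        refine (hlip s hsmem r (hsub hr)).trans_lt (lt_of_le_of_lt ?_ htη)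
        rw [Real.norm_eq_abs]
        exact mul_le_mul_of_nonneg_left (abs_sub_left_of_mem_uIcc hr) (by positivity)
      have h7 := hηG _ hrK _ hsK h6
      have h8 := h4 _ hrK
      rw [dist_eq_norm] at h7 h8
      have e : Gn n (y n r) - G (y n s)
          = (G (y n r) - G (y n s)) - (G (y n r) - Gn n (y n r)) := by abel
      rw [e]
      exact (norm_sub_le _ _).trans (by linarith)
  have hGs : Tendsto (fun n => G (y n s)) U (𝓝 (G (z s))) := by
    refine (hG (z s) (hz s hs).1).tendsto.comp (tendsto_nhdsWithin_iff.2 ⟨(hz s hs).2, ?_⟩)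
    filter_upwards [hev s] with n hn using hyK n s ⟨hs, hn⟩
  have hlim : Tendsto (fun n => ‖y n t - y n s - (t - s) • G (y n s)‖) U
      (𝓝 ‖z t - z s - (t - s) • G (z s)‖) :=
    ((((hz t ht0).2).sub (hz s hs).2).sub (hGs.const_smul (t - s))).norm
  exact le_of_tendsto hlim hn

/-! ### The optimality system and the existence of extremals -/

namespace Model

variable {M : Model}

/-- The drift of the costate `q`, which is the marginal value of the conditional variance. -/
noncomputable def adj (M : Model) (γ h q : ℝ) : ℝ :=
  (M.δ + 2 * M.lam + 2 * ((1 / M.σ₁) ^ 2 + h) * γ) * q - M.abar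

/-- The vector field of the pair of state and costate if the rate is the function `r` of the
shadow price `γ ^ 2 * q` of the precision. -/
noncomputable def field (M : Model) (r : ℝ → ℝ) (y : ℝ × ℝ) : ℝ × ℝ :=
  (M.f y.1 (r (y.1 ^ 2 * y.2)), M.adj y.1 (r (y.1 ^ 2 * y.2)) y.2)

/-- The range of the pairs of state and costate. -/
def box (M : Model) : Set (ℝ × ℝ) := Icc 0 M.γmax ×ˢ Icc 0 (M.abar / M.δ)

/-- `γ` and `q` solve the optimality system consisting of the state equation, the costate equation
and the maximum principle, which reads `h = rate (γ ^ 2 * q)`. -/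
structure IsExtremal (M : Model) (γ q : ℝ → ℝ) : Prop where
  γ_mem : ∀ t, 0 ≤ t → γ t ∈ Icc 0 M.γmax
  q_mem : ∀ t, 0 ≤ t → q t ∈ Icc 0 (M.abar / M.δ)
  γ_deriv : ∀ t, 0 ≤ t →
    HasDerivWithinAt γ (M.f (γ t) (M.rate (γ t ^ 2 * q t))) (Ici 0) t
  q_deriv : ∀ t, 0 ≤ t →
    HasDerivWithinAt q (M.adj (γ t) (M.rate (γ t ^ 2 * q t)) (q t)) (Ici 0) t

lemma isExtremal_of_box {y : ℝ → ℝ × ℝ}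
    (hy : ∀ t, 0 ≤ t → y t ∈ M.box ∧ HasDerivWithinAt y (M.field M.rate (y t)) (Ici 0) t) :
    M.IsExtremal (fun t => (y t).1) (fun t => (y t).2) where
  γ_mem t ht := (hy t ht).1.1
  q_mem t ht := (hy t ht).1.2
  γ_deriv t ht := (hy t ht).2.fst
  q_deriv t ht := (hy t ht).2.snd

namespace Standing

lemma isCompact_box (M : Model) : IsCompact M.box := isCompact_Icc.prod isCompact_Icc

lemma convex_box (M : Model) : Convex ℝ M.box := (convex_Icc _ _).prod (convex_Icc _ _)

lemma price_mem (hM : M.Standing) {y : ℝ × ℝ} (hy : y ∈ M.box) :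
    y.1 ^ 2 * y.2 ∈ Icc 0 M.M₀ := by
  obtain ⟨⟨h1, h2⟩, h3, h4⟩ := hy
  have := hM.γmax_pos
  refine ⟨by positivity, ?_⟩
  unfold M₀
  gcongr

/-- The drift is negative at the upper end of the state space. -/
lemma f_γmax_neg (hM : M.Standing) {h : ℝ} (hh : 0 ≤ h) : M.f M.γmax h < 0 := by
  have hs := hM.σ₁_pos
  have hg := hM.γmax_pos
  have h1 := hM.γInf_lt
  unfold γInf at h1
  have h2 : M.lam ^ 2 * M.σ₁ ^ 4 + M.σ₁ ^ 2 * M.σ₂ ^ 2 < (M.γmax + M.lam * M.σ₁ ^ 2) ^ 2 := by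
    rw [← Real.sqrt_lt' (by have := hM.lam_nonneg; positivity)]
    linarith
  have h3 : M.σ₁ ^ 2 * M.σ₂ ^ 2 < M.γmax ^ 2 + 2 * M.lam * M.γmax * M.σ₁ ^ 2 := by nlinarith
  have h4 : M.f M.γmax 0 < 0 := by
    have e : M.f M.γmax 0 = (M.σ₁ ^ 2 * M.σ₂ ^ 2 - (M.γmax ^ 2 + 2 * M.lam * M.γmax * M.σ₁ ^ 2))
        / M.σ₁ ^ 2 := by
      unfold f
      field_simp
      ring
    rw [e]
    exact div_neg_of_neg_of_pos (by linarith) (by positivity)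
  have : M.f M.γmax h = M.f M.γmax 0 - h * M.γmax ^ 2 := by unfold f; ring
  nlinarith [mul_nonneg hh (sq_nonneg M.γmax)]

/-- A shooting argument: the initial costate is varied until the costate vanishes at time `T`.
Terminal values in the costate range confine the costate backward in time, and the signs of the
drift at the two ends confine the state forward in time. -/
lemma exists_box_solution (hM : M.Standing) {r : ℝ → ℝ} (hr : ContDiff ℝ 1 r)
    (hr0 : ∀ p ∈ Icc 0 M.M₀, 0 ≤ r p) {γ₀ : ℝ} (hγ₀ : γ₀ ∈ Icc 0 M.γmax) {T : ℝ} (hT : 0 ≤ T) :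
    ∃ y : ℝ → ℝ × ℝ, (y 0).1 = γ₀ ∧ ∀ t ∈ Icc 0 T, y t ∈ M.box ∧
      HasDerivWithinAt y (M.field r (y t)) (Icc 0 T) t := by
  have hg := hM.γmax_pos
  have ha := hM.abar_pos
  have hδ := hM.δ_pos
  have hlam := hM.lam_nonneg
  set Q := M.abar / M.δ with hQ
  have hQ0 : 0 < Q := by positivity
  have hQδ : M.δ * Q = M.abar := by rw [hQ]; field_simp
  -- Evaluating the field at the projection onto `box` makes it bounded and globally Lipschitz. The
  -- solution found stays in `box`, where the projection is the identity.
  let cl : ℝ × ℝ → ℝ × ℝ := fun y => (max 0 (min y.1 M.γmax), max 0 (min y.2 Q))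
  have hcl : ∀ y, cl y ∈ M.box := fun y =>
    ⟨⟨le_max_left _ _, max_le hg.le (min_le_right _ _)⟩,
      ⟨le_max_left _ _, max_le hQ0.le (min_le_right _ _)⟩⟩
  have hclb : ∀ y ∈ M.box, cl y = y := by
    rintro ⟨y1, y2⟩ ⟨⟨h1, h2⟩, h3, h4⟩
    simp only [cl, Prod.mk.injEq]
    exact ⟨by rw [min_eq_left h2, max_eq_right h1], by rw [min_eq_left h4, max_eq_right h3]⟩
  have hcl_lip : LipschitzWith 1 cl := by
    have h1 : LipschitzWith 1 fun y : ℝ × ℝ => max 0 (min y.1 M.γmax) :=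
      (LipschitzWith.prod_fst.min_const _).const_max _
    have h2 : LipschitzWith 1 fun y : ℝ × ℝ => max 0 (min y.2 Q) :=
      (LipschitzWith.prod_snd.min_const _).const_max _
    simpa using h1.prodMk h2
  have hfield : ContDiff ℝ 1 (M.field r) := by
    unfold field f adj
    fun_prop
  obtain ⟨K, hK⟩ := hfield.contDiffOn.exists_lipschitzOnWith (by decide) (convex_box M)
    (isCompact_box M)
  obtain ⟨L, hL⟩ := (isCompact_box M).exists_bound_of_continuousOn hfield.continuous.continuousOn
  have hF : LipschitzWith K fun y => M.field r (cl y) := by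
    have := (hK.comp (hcl_lip.lipschitzOnWith (s := univ)) fun y _ => hcl y)
    rw [mul_one] at this
    exact lipschitzOnWith_univ.1 this
  -- Initial costates in `[-1, Q + 1]` lie in the ball of radius `Q + 1` about `0`, and a solution
  -- moves by at most `L * T`.
  have hpl : IsPicardLindelof (fun _ y => M.field r (cl y)) (tmin := 0) (tmax := T)
      ⟨0, le_rfl, hT⟩ (γ₀, 0) (L.toNNReal * T.toNNReal + (Q + 1).toNNReal) (Q + 1).toNNReal
      L.toNNReal K := by
    refine ⟨fun t _ => hF.lipschitzOnWith, fun x _ => continuousOn_const, fun t _ x _ =>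
      (hL _ (hcl x)).trans (Real.le_coe_toNNReal L), ?_⟩
    simp [hT]
  obtain ⟨Y, hY, L', hL'⟩ := hpl.exists_forall_mem_closedBall_eq_hasDerivWithinAt_lipschitzOnWith
  have hball : ∀ q ∈ Icc (-1) (Q + 1), (γ₀, q) ∈
      Metric.closedBall ((γ₀, 0) : ℝ × ℝ) ((Q + 1).toNNReal : ℝ) := by
    intro q hq
    rw [Metric.mem_closedBall, Prod.dist_eq, Real.coe_toNNReal _ (by linarith)]
    simp only [dist_self, Real.dist_eq, sub_zero]
    rw [max_le_iff, abs_le]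
    exact ⟨by linarith, by linarith [hq.1], hq.2⟩
  have hd : ∀ q ∈ Icc (-1) (Q + 1), ∀ t ∈ Icc 0 T,
      HasDerivWithinAt (Y (γ₀, q)) (M.field r (cl (Y (γ₀, q) t))) (Icc 0 T) t := fun q hq =>
    (hY _ (hball q hq)).2
  have hcont : ContinuousOn (fun q => (Y (γ₀, q) T).2) (Icc (-1) (Q + 1)) :=
    continuous_snd.comp_continuousOn ((hL' T ⟨hT, le_rfl⟩).continuousOn.comp
      (by fun_prop) hball)
  have hrcl : ∀ y, 0 ≤ r ((cl y).1 ^ 2 * (cl y).2) := fun y => hr0 _ (hM.price_mem (hcl y))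
  -- Below `0` the projected costate drift is `-abar < 0`; above `Q` it is at least `δ * Q - abar =
  -- 0`. So the costate cannot leave `[0, Q]` backward in time.
  have hlow : ∀ q ∈ Icc (-1) (Q + 1), 0 ≤ (Y (γ₀, q) T).2 →
      ∀ t ∈ Icc 0 T, 0 ≤ (Y (γ₀, q) t).2 := fun q hq hq0 =>
    nonneg_of_hasDerivWithinAt_right (fun t ht => (hd q hq t ht).snd) hq0 fun t ht hlt => by
      have : (cl (Y (γ₀, q) t)).2 = 0 := by
        simp only [cl]
        exact max_eq_left (min_le_of_left_le hlt.le)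
      simp only [field, adj, this]
      linarith
  have hhigh : ∀ q ∈ Icc (-1) (Q + 1), (Y (γ₀, q) T).2 ≤ Q →
      ∀ t ∈ Icc 0 T, (Y (γ₀, q) t).2 ≤ Q := by
    intro q hq hq0 t ht
    have key := nonneg_of_hasDerivWithinAt_right (u := fun t => Q - (Y (γ₀, q) t).2)
      (fun t ht => HasDerivWithinAt.const_sub Q (hd q hq t ht).snd) (by simpa using hq0) ?_ t ht
    · simpa using key
    intro t ht hlt
    have h1 : (cl (Y (γ₀, q) t)).2 = Q := by
      simp only [cl]
      rw [min_eq_right (by linarith), max_eq_right hQ0.le]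
    have h2 := hrcl (Y (γ₀, q) t)
    have h3 := (hcl (Y (γ₀, q) t)).1.1
    simp only [field, adj, h1] at h2 ⊢
    have : 0 ≤ (2 * M.lam + 2 * ((1 / M.σ₁) ^ 2 + r ((cl (Y (γ₀, q) t)).1 ^ 2 * Q)) *
      (cl (Y (γ₀, q) t)).1) * Q := by positivity
    nlinarith
  -- The end values `-1` and `Q + 1` lie outside `[0, Q]`, so by the two bounds the terminal
  -- costates have opposite signs or vanish.
  obtain ⟨q, hq, hq0⟩ : ∃ q ∈ Icc (-1) (Q + 1), (Y (γ₀, q) T).2 = 0 := by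
    have hl : (-1 : ℝ) ∈ Icc (-1) (Q + 1) := ⟨le_rfl, by linarith⟩
    have hrr : Q + 1 ∈ Icc (-1) (Q + 1) := ⟨by linarith, le_rfl⟩
    have h0 : (0 : ℝ) ∈ Icc 0 T := ⟨le_rfl, hT⟩
    have h1 : (Y (γ₀, -1) T).2 ≤ 0 := by
      by_contra! h
      have := hlow _ hl h.le 0 h0
      rw [(hY _ (hball _ hl)).1] at this
      simp at this
      linarith
    have h2 : 0 ≤ (Y (γ₀, Q + 1) T).2 := by
      by_contra! h
      have := hhigh _ hrr (by linarith) 0 h0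
      rw [(hY _ (hball _ hrr)).1] at this
      simp at this
      linarith
    exact intermediate_value_Icc (by linarith) hcont ⟨h1, h2⟩
  have hY0 : Y (γ₀, q) 0 = (γ₀, q) := (hY _ (hball q hq)).1
  have hγlow : ∀ t ∈ Icc 0 T, 0 ≤ (Y (γ₀, q) t).1 :=
    nonneg_of_hasDerivWithinAt (fun t ht => (hd q hq t ht).fst) (by rw [hY0]; exact hγ₀.1)
      fun t ht hlt => by
        have : (cl (Y (γ₀, q) t)).1 = 0 := by
          simp only [cl]
          exact max_eq_left (min_le_of_left_le hlt.le)
        simp only [field, f, this]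
        nlinarith [sq_nonneg M.σ₂]
  have hγhigh : ∀ t ∈ Icc 0 T, (Y (γ₀, q) t).1 ≤ M.γmax := by
    intro t ht
    have key := nonneg_of_hasDerivWithinAt (u := fun t => M.γmax - (Y (γ₀, q) t).1)
      (fun t ht => HasDerivWithinAt.const_sub M.γmax (hd q hq t ht).fst) (by simp [hY0, hγ₀.2]) ?_ t ht
    · simpa using key
    intro t ht hlt
    have h1 : (cl (Y (γ₀, q) t)).1 = M.γmax := by
      simp only [cl]
      rw [min_eq_right (by linarith), max_eq_right hg.le]
    have h2 := hrcl (Y (γ₀, q) t)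
    simp only [field, h1] at h2 ⊢
    linarith [hM.f_γmax_neg h2]
  refine ⟨Y (γ₀, q), by rw [hY0], fun t ht => ?_⟩
  have hmem : Y (γ₀, q) t ∈ M.box := ⟨⟨hγlow t ht, hγhigh t ht⟩,
    hlow q hq hq0.ge t ht, hhigh q hq (by linarith) t ht⟩
  refine ⟨hmem, ?_⟩
  have := hd q hq t ht
  rwa [hclb _ hmem] at this

lemma continuousOn_field (hM : M.Standing) : ContinuousOn (M.field M.rate) M.box := by
  have h1 : ContinuousOn (fun y : ℝ × ℝ => M.rate (y.1 ^ 2 * y.2)) M.box :=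
    hM.continuousOn_rate.comp (by fun_prop) fun y hy => (hM.price_mem hy).2
  unfold field f adj
  fun_prop

lemma exists_isExtremal (hM : M.Standing) {γ₀ : ℝ} (hγ₀ : γ₀ ∈ Icc 0 M.γmax) :
    ∃ γ q, M.IsExtremal γ q ∧ γ 0 = γ₀ := by
  have hg := hM.γmax_pos
  have hQ0 : 0 < M.abar / M.δ := div_pos hM.abar_pos hM.δ_pos
  -- A polynomial within `1 / (n + 1)` of `rate` is raised by `1 / (n + 1)` to be nonnegative, which
  -- doubles the error.
  have hpoly : ∀ n : ℕ, ∃ r : ℝ → ℝ, ContDiff ℝ 1 r ∧ ∀ p ∈ Icc 0 M.M₀, 0 ≤ r p ∧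
      |M.rate p - r p| < 2 / ((n : ℝ) + 1) := by
    intro n
    have hn : (0 : ℝ) < 1 / ((n : ℝ) + 1) := by positivity
    obtain ⟨P, hP⟩ := exists_polynomial_near_of_continuousOn 0 M.M₀ M.rate
      (hM.continuousOn_rate.mono fun p hp => hp.2) _ hn
    refine ⟨fun p => P.eval p + 1 / ((n : ℝ) + 1), (by simpa using P.contDiff_aeval (𝕜 := ℝ) 1 |>.add contDiff_const), fun p hp => ?_⟩
    have h1 := abs_lt.1 (hP p hp)
    have h2 := rate_nonneg M p
    refine ⟨by linarith, ?_⟩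
    have e : 2 / ((n : ℝ) + 1) = 1 / ((n : ℝ) + 1) + 1 / ((n : ℝ) + 1) := by ring
    rw [abs_lt, e]
    constructor <;> linarith
  choose r hr hrp using hpoly
  have hsol : ∀ n : ℕ, ∃ y : ℝ → ℝ × ℝ, (y 0).1 = γ₀ ∧ ∀ t ∈ Icc 0 (n : ℝ), y t ∈ M.box ∧
      HasDerivWithinAt y (M.field (r n) (y t)) (Icc 0 (n : ℝ)) t := fun n =>
    hM.exists_box_solution (hr n) (fun p hp => (hrp n p hp).1) hγ₀ n.cast_nonneg
  choose y hy0 hy using hsol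
  have hunif : TendstoUniformlyOn (fun n => M.field (r n)) (M.field M.rate) atTop M.box := by
    rw [Metric.tendstoUniformlyOn_iff]
    intro ε hε
    -- `C` dominates both factors that multiply the error of the rate: `γ ^ 2` in the drift and `2 *
    -- γ * q` in the costate equation.
    set C := M.γmax ^ 2 + 2 * M.γmax * (M.abar / M.δ) with hC
    have hlim : Tendsto (fun n : ℕ => C * (2 * (1 / ((n : ℝ) + 1)))) atTop (𝓝 0) := by
      simpa using (tendsto_one_div_add_atTop_nhds_zero_nat (𝕜 := ℝ)).const_mul 2 |>.const_mul C
    filter_upwards [hlim.eventually (gt_mem_nhds hε)] with n hn w hw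
    have h1 := (hrp n _ (hM.price_mem hw)).2
    obtain ⟨⟨h2, h3⟩, h4, h5⟩ := hw
    refine lt_of_le_of_lt ?_ hn
    set d := M.rate (w.1 ^ 2 * w.2) - r n (w.1 ^ 2 * w.2) with hd
    have e1 : M.f w.1 (M.rate (w.1 ^ 2 * w.2)) - M.f w.1 (r n (w.1 ^ 2 * w.2)) = -(w.1 ^ 2) * d := by
      rw [hd]; unfold f; ring
    have e2 : M.adj w.1 (M.rate (w.1 ^ 2 * w.2)) w.2 - M.adj w.1 (r n (w.1 ^ 2 * w.2)) w.2
        = 2 * w.1 * w.2 * d := by rw [hd]; unfold adj; ring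
    have h6 : |d| ≤ 2 * (1 / ((n : ℝ) + 1)) := by rw [mul_one_div]; exact h1.le
    have h7 : w.1 ^ 2 ≤ C := by
      have : w.1 ^ 2 ≤ M.γmax ^ 2 := by gcongr
      have : 0 ≤ 2 * M.γmax * (M.abar / M.δ) := by positivity
      linarith
    have h8 : 2 * w.1 * w.2 ≤ C := by
      have : 2 * w.1 * w.2 ≤ 2 * M.γmax * (M.abar / M.δ) := by gcongr
      nlinarith
    rw [Prod.dist_eq, max_le_iff]
    simp only [field, Real.dist_eq, e1, e2, abs_mul, abs_neg, abs_pow, abs_of_nonneg h2,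
      abs_of_nonneg h4, abs_two]
    exact ⟨by gcongr, by gcongr⟩
  obtain ⟨z, hz, U, hU, hzU⟩ := exists_limit_solution (isCompact_box M) hM.continuousOn_field hunif
    tendsto_natCast_atTop_atTop (fun n t ht => (hy n t ht).1) (fun n t ht => (hy n t ht).2)
  refine ⟨_, _, isExtremal_of_box hz, ?_⟩
  have h1 : Tendsto (fun n => (y n 0).1) U (𝓝 (z 0).1) := (continuous_fst.tendsto _).comp hzU
  simp only [hy0] at h1
  exact tendsto_nhds_unique h1 tendsto_const_nhds |>.symm ▸ rfl

/-- The set of extremals is closed. -/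
lemma exists_isExtremal_of_tendsto (hM : M.Standing) {γ q : ℕ → ℝ → ℝ}
    (hγq : ∀ n, M.IsExtremal (γ n) (q n)) {γ₀ : ℝ}
    (hγ₀ : Tendsto (fun n => γ n 0) atTop (𝓝 γ₀)) :
    ∃ γ' q', M.IsExtremal γ' q' ∧ γ' 0 = γ₀ ∧
      ∃ U : Ultrafilter ℕ, (U : Filter ℕ) ≤ atTop ∧ Tendsto (fun n => q n 0) U (𝓝 (q' 0)) := by
  obtain ⟨z, hz, U, hU, hzU⟩ := exists_limit_solution (isCompact_box M) hM.continuousOn_field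
    (Gn := fun _ => M.field M.rate) (Metric.tendstoUniformlyOn_iff.2 fun ε hε => by simp [hε])
    (y := fun n t => (γ n t, q n t)) tendsto_natCast_atTop_atTop
    (fun n t ht => ⟨(hγq n).γ_mem t ht.1, (hγq n).q_mem t ht.1⟩)
    (fun n t ht => (((hγq n).γ_deriv t ht.1).prodMk ((hγq n).q_deriv t ht.1)).mono
      fun s hs => hs.1)
  refine ⟨_, _, isExtremal_of_box hz, ?_, U, hU, (continuous_snd.tendsto _).comp hzU⟩
  have h1 : Tendsto (fun n => γ n 0) U (𝓝 (z 0).1) := (continuous_fst.tendsto _).comp hzU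
  exact tendsto_nhds_unique h1 (hγ₀.mono_left hU)

end Standing

end Model

/-! ### Calculus of absolutely continuous functions -/

lemma AbsolutelyContinuousOnInterval.lipschitz_comp {f φ : ℝ → ℝ} {a b : ℝ} {K : NNReal}
    (hf : AbsolutelyContinuousOnInterval f a b) (hφ : LipschitzOnWith K φ (f '' uIcc a b)) :
    AbsolutelyContinuousOnInterval (fun x => φ (f x)) a b := by
  rw [absolutelyContinuousOnInterval_iff] at hf ⊢
  intro ε hε
  obtain ⟨η, hη, h⟩ := hf (ε / (K + 1)) (by positivity)
  refine ⟨η, hη, fun E hE hlt => ?_⟩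
  have h1 := h E hE hlt
  calc _ ≤ ∑ i ∈ Finset.range E.1, (K : ℝ) * dist (f (E.2 i).1) (f (E.2 i).2) :=
        Finset.sum_le_sum fun i hi => hφ.dist_le_mul _ (mem_image_of_mem f (hE.1 i hi).1) _
          (mem_image_of_mem f (hE.1 i hi).2)
    _ = K * ∑ i ∈ Finset.range E.1, dist (f (E.2 i).1) (f (E.2 i).2) := by
        rw [Finset.mul_sum]
    _ ≤ K * (ε / (K + 1)) := by gcongr
    _ < (K + 1) * (ε / (K + 1)) := by gcongr; linarith
    _ = ε := by field_simp

lemma AbsolutelyContinuousOnInterval.congr_uIcc {f g : ℝ → ℝ} {a b : ℝ}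
    (hf : AbsolutelyContinuousOnInterval f a b) (hfg : EqOn f g (uIcc a b)) :
    AbsolutelyContinuousOnInterval g a b := by
  rw [absolutelyContinuousOnInterval_iff] at hf ⊢
  intro ε hε
  obtain ⟨η, hη, h⟩ := hf ε hε
  refine ⟨η, hη, fun E hE hlt => lt_of_le_of_lt (le_of_eq ?_) (h E hE hlt)⟩
  refine Finset.sum_congr rfl fun i hi => ?_
  rw [hfg (hE.1 i hi).1, hfg (hE.1 i hi).2]

lemma AbsolutelyContinuousOnInterval.inv_of_le {f : ℝ → ℝ} {a b m : ℝ}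
    (hf : AbsolutelyContinuousOnInterval f a b) (hm : 0 < m) (hfm : ∀ x ∈ uIcc a b, m ≤ f x) :
    AbsolutelyContinuousOnInterval (fun x => (f x)⁻¹) a b := by
  refine hf.lipschitz_comp (K := ((m ^ 2)⁻¹).toNNReal) (φ := fun y => y⁻¹)
    (LipschitzOnWith.of_dist_le_mul ?_)
  rintro _ ⟨x, hx, rfl⟩ _ ⟨y, hy, rfl⟩
  have h1 := hfm x hx
  have h2 := hfm y hy
  have h3 : 0 < f x := hm.trans_le h1
  have h4 : 0 < f y := hm.trans_le h2
  rw [Real.coe_toNNReal _ (by positivity), Real.dist_eq, Real.dist_eq, inv_sub_inv h3.ne' h4.ne',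
    abs_div, abs_of_pos (mul_pos h3 h4), abs_sub_comm, div_eq_inv_mul]
  gcongr
  nlinarith

/-- The fundamental theorem of calculus for an absolutely continuous function and a given version
of its derivative. -/
lemma AbsolutelyContinuousOnInterval.integral_eq_sub_of_ae_hasDerivAt {F F' : ℝ → ℝ} {a b : ℝ}
    (hF : AbsolutelyContinuousOnInterval F a b) (hab : a ≤ b)
    (hd : ∀ᵐ t, t ∈ Ioo a b → HasDerivAt F (F' t) t) :
    IntervalIntegrable F' volume a b ∧ ∫ t in a..b, F' t = F b - F a := by
  have hne : ∀ᵐ t : ℝ, t ≠ b := by simp [ae_iff, measure_singleton]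
  have h : ∀ᵐ t, t ∈ uIoc a b → deriv F t = F' t := by
    filter_upwards [hd, hne] with t ht htb hmem
    rw [uIoc_of_le hab] at hmem
    exact (ht ⟨hmem.1, lt_of_le_of_ne hmem.2 htb⟩).deriv
  exact ⟨hF.intervalIntegrable_deriv.congr_ae ((ae_restrict_iff' measurableSet_uIoc).2 h),
    by rw [← hF.integral_deriv_eq_sub]; exact (intervalIntegral.integral_congr_ae h).symm⟩

lemma exists_integrating_factor {B : ℝ → ℝ} (hB : Continuous B) :
    ∃ e : ℝ → ℝ, (∀ t, HasDerivAt e (B t * e t) t) ∧ (∀ t, 0 < e t) ∧ ContDiff ℝ 1 e := by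
  have hd : ∀ t, HasDerivAt (fun t => Real.exp (∫ s in (0 : ℝ)..t, B s))
      (B t * Real.exp (∫ s in (0 : ℝ)..t, B s)) t := fun t => by
    have := (intervalIntegral.integral_hasDerivAt_right (hB.intervalIntegrable 0 t)
      (hB.stronglyMeasurableAtFilter _ _) hB.continuousAt).exp
    rwa [mul_comm] at this
  refine ⟨_, hd, fun t => Real.exp_pos _, ?_⟩
  rw [contDiff_one_iff_deriv]
  refine ⟨fun t => (hd t).differentiableAt, ?_⟩
  have h1 : Continuous fun t => Real.exp (∫ s in (0 : ℝ)..t, B s) :=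
    continuous_iff_continuousAt.2 fun t => (hd t).continuousAt
  rw [funext fun t => (hd t).deriv]
  exact hB.mul h1

/-- An absolutely continuous function `u` with `u' + B u ≥ k ≥ 0` preserves nonnegativity, and
it becomes positive if it starts so or if `k > 0`. -/
lemma nonneg_and_pos_of_ae_hasDerivAt {u g B : ℝ → ℝ} {a b k : ℝ} (hab : a ≤ b)
    (hu : AbsolutelyContinuousOnInterval u a b)
    (hd : ∀ᵐ t, t ∈ Ioo a b → HasDerivAt u (g t) t) (hB : Continuous B) (hk : 0 ≤ k)
    (hg : ∀ t ∈ Ioo a b, k ≤ g t + B t * u t) (ha : 0 ≤ u a) :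
    0 ≤ u b ∧ (0 < u a ∨ 0 < k ∧ a < b → 0 < u b) := by
  obtain ⟨e, he, hpos, hcd⟩ := exists_integrating_factor hB
  have hac : AbsolutelyContinuousOnInterval (fun t => e t * u t) a b :=
    hcd.contDiffOn.absolutelyContinuousOnInterval.fun_mul hu
  have hd' : ∀ᵐ t, t ∈ Ioo a b → HasDerivAt (fun t => e t * u t) (e t * (g t + B t * u t)) t := by
    filter_upwards [hd] with t ht hmem
    exact ((he t).mul (ht hmem)).congr_deriv (by ring)
  -- With the integrating factor, `(e u)' = e (g + B u) ≥ k e`, so `e u` grows by at least `k ∫ e`.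
  obtain ⟨hint, heq⟩ := hac.integral_eq_sub_of_ae_hasDerivAt hab hd'
  have hne : ∀ᵐ t : ℝ, t ∈ Ioo a b ↔ t ∈ Icc a b := by
    have h1 : ∀ᵐ t : ℝ, t ≠ a := by simp [ae_iff, measure_singleton]
    have h2 : ∀ᵐ t : ℝ, t ≠ b := by simp [ae_iff, measure_singleton]
    filter_upwards [h1, h2] with t h1 h2
    exact ⟨fun h => ⟨h.1.le, h.2.le⟩, fun h => ⟨lt_of_le_of_ne h.1 h1.symm, lt_of_le_of_ne h.2 h2⟩⟩
  have hle : ∫ t in a..b, k * e t ≤ ∫ t in a..b, e t * (g t + B t * u t) := by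
    refine intervalIntegral.integral_mono_ae_restrict hab
      ((hcd.continuous.const_mul k).intervalIntegrable a b) hint ?_
    refine (ae_restrict_iff' measurableSet_Icc).2 ?_
    filter_upwards [hne] with t ht hmem
    rw [mul_comm]
    exact mul_le_mul_of_nonneg_left (hg t (ht.2 hmem)) (hpos t).le
  rw [heq, intervalIntegral.integral_const_mul] at hle
  have h0 : 0 ≤ ∫ t in a..b, e t := intervalIntegral.integral_nonneg hab fun t _ => (hpos t).le
  have h1 : 0 ≤ k * ∫ t in a..b, e t := mul_nonneg hk h0
  have h2 : 0 ≤ e a * u a := mul_nonneg (hpos a).le ha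
  refine ⟨?_, ?_⟩
  · by_contra! hlt
    nlinarith [mul_neg_of_pos_of_neg (hpos b) hlt]
  · rintro (h | ⟨h, h'⟩)
    · have := mul_pos (hpos a) h
      exact pos_of_mul_pos_right (by linarith : 0 < e b * u b) (hpos b).le
    · have := mul_pos h (intervalIntegral.intervalIntegral_pos_of_pos
        (hcd.continuous.intervalIntegrable a b) hpos h')
      exact pos_of_mul_pos_right (by linarith : 0 < e b * u b) (hpos b).le

/-! ### Bounds for controlled states -/

namespace Model

variable {M : Model} {γ₀ : ℝ} {h γ : ℝ → ℝ}

lemma Admissible.aestronglyMeasurable (hh : M.Admissible h) :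
    AEStronglyMeasurable h (volume.restrict (Ici 0)) :=
  (aemeasurable_restrict_of_measurable_subtype measurableSet_Ici hh.1).aestronglyMeasurable

lemma uIoc_subset_Ici {a b : ℝ} (ha : 0 ≤ a) (hb : 0 ≤ b) : uIoc a b ⊆ Ici (0 : ℝ) :=
  fun _ ht => (le_min ha hb).trans ht.1.le

lemma uIcc_subset_Ici {a b : ℝ} (ha : 0 ≤ a) (hb : 0 ≤ b) : uIcc a b ⊆ Ici (0 : ℝ) :=
  fun _ ht => (le_min ha hb).trans ht.1

lemma Admissible.intervalIntegrable (hh : M.Admissible h) {a b : ℝ} (ha : 0 ≤ a) (hb : 0 ≤ b) :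
    IntervalIntegrable h volume a b := by
  rw [intervalIntegrable_iff]
  have : IsFiniteMeasure (volume.restrict (uIoc a b)) := by rw [uIoc]; infer_instance
  refine Integrable.of_bound (hh.aestronglyMeasurable.mono_set (uIoc_subset_Ici ha hb)) M.hmax ?_
  refine (ae_restrict_iff' measurableSet_uIoc).2 (Eventually.of_forall fun t ht => ?_)
  have := hh.2 t (uIoc_subset_Ici ha hb ht)
  rw [Real.norm_eq_abs, abs_of_nonneg this.1]
  exact this.2

namespace IsState

lemma intervalIntegrable (hs : M.IsState γ₀ h γ) (hh : M.Admissible h) {a b : ℝ} (ha : 0 ≤ a)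
    (hb : 0 ≤ b) : IntervalIntegrable (fun t => M.f (γ t) (h t)) volume a b := by
  have hc : ContinuousOn γ (uIcc a b) := hs.1.mono (uIcc_subset_Ici ha hb)
  have h1 : IntervalIntegrable (fun t => h t * (-(γ t) ^ 2)) volume a b :=
    (hh.intervalIntegrable ha hb).mul_continuousOn (by fun_prop)
  have h2 : IntervalIntegrable (fun t => -(1 / M.σ₁) ^ 2 * γ t ^ 2 - 2 * M.lam * γ t + M.σ₂ ^ 2)
      volume a b := ContinuousOn.intervalIntegrable (by fun_prop)
  refine (h1.add h2).congr fun t _ => ?_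
  simp only [f]
  ring

lemma absolutelyContinuousOnInterval (hs : M.IsState γ₀ h γ) (hh : M.Admissible h) {a b : ℝ}
    (ha : 0 ≤ a) (hb : 0 ≤ b) : AbsolutelyContinuousOnInterval γ a b := by
  have hm : 0 ≤ max a b := ha.trans (le_max_left _ _)
  have h1 := (hs.intervalIntegrable hh le_rfl hm).absolutelyContinuousOnInterval_intervalIntegral
    (c := 0) left_mem_uIcc
  have h2 : AbsolutelyContinuousOnInterval (fun _ : ℝ => γ₀) 0 (max a b) :=
    contDiff_const.contDiffOn.absolutelyContinuousOnInterval
  have h3 : AbsolutelyContinuousOnInterval γ 0 (max a b) := by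
    refine (h2.fun_add h1).congr_uIcc fun t ht => ?_
    rw [uIcc_of_le hm] at ht
    exact (hs.2 t ht.1).symm
  refine h3.mono ?_
  rw [uIcc_of_le hm]
  exact fun t ht => ⟨(le_min ha hb).trans ht.1, ht.2⟩

/-- Lebesgue differentiation on each `[0, n]`. The rate is only measurable, so the state equation
holds pointwise only almost everywhere. -/
lemma ae_hasDerivAt (hs : M.IsState γ₀ h γ) (hh : M.Admissible h) :
    ∀ᵐ t, 0 < t → HasDerivAt γ (M.f (γ t) (h t)) t := by
  have h1 : ∀ᵐ t, ∀ n : ℕ, t ∈ uIcc 0 (n : ℝ) → ∀ c ∈ uIcc 0 (n : ℝ),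
      HasDerivAt (fun x => ∫ t in c..x, M.f (γ t) (h t)) (M.f (γ t) (h t)) t :=
    ae_all_iff.2 fun n => (hs.intervalIntegrable hh le_rfl n.cast_nonneg).ae_hasDerivAt_integral
  filter_upwards [h1] with t ht h0
  obtain ⟨n, hn⟩ := exists_nat_ge t
  have h2 := (ht n (by rw [uIcc_of_le n.cast_nonneg]; exact ⟨h0.le, hn⟩) 0
    left_mem_uIcc).const_add γ₀
  refine h2.congr_of_eventuallyEq ?_
  filter_upwards [Ioi_mem_nhds h0] with s hs'
  exact hs.2 s (le_of_lt hs')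

lemma zero (hs : M.IsState γ₀ h γ) : γ 0 = γ₀ := by simpa using hs.2 0 le_rfl

lemma continuous_max (hs : M.IsState γ₀ h γ) : Continuous fun t => γ (max t 0) :=
  hs.1.comp_continuous (by fun_prop) fun t => le_max_right t 0

lemma nonneg_and_pos (hs : M.IsState γ₀ h γ) (hh : M.Admissible h) (h0 : 0 ≤ γ₀) {t : ℝ}
    (ht : 0 ≤ t) : 0 ≤ γ t ∧ (0 < γ₀ ∨ M.σ₂ ≠ 0 ∧ 0 < t → 0 < γ t) := by
  have key := nonneg_and_pos_of_ae_hasDerivAt ht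
    (hs.absolutelyContinuousOnInterval hh le_rfl ht)
    (g := fun t => M.f (γ t) (h t))
    -- With this `B`, `f γ h + B γ = σ₂² + (hmax - h) γ² ≥ σ₂²`. The argument `max t 0` only makes
    -- `B` continuous on the whole line.
    (B := fun t => ((1 / M.σ₁) ^ 2 + M.hmax) * γ (max t 0) + 2 * M.lam) (k := M.σ₂ ^ 2)
    (by filter_upwards [hs.ae_hasDerivAt hh] with s h1 h2 using h1 h2.1)
    ((hs.continuous_max.const_mul _).add continuous_const) (sq_nonneg _) ?_ (by rw [hs.zero]; exact h0)
  · rw [hs.zero] at key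
    refine ⟨key.1, fun h' => key.2 (h'.imp_right fun h'' => ⟨by have := h''.1; positivity, h''.2⟩)⟩
  · intro s hs'
    have h1 := (hh.2 s hs'.1.le).2
    simp only [max_eq_left hs'.1.le, f]
    nlinarith [mul_nonneg (sub_nonneg.2 h1) (sq_nonneg (γ s))]

lemma nonneg (hs : M.IsState γ₀ h γ) (hh : M.Admissible h) (h0 : 0 ≤ γ₀) {t : ℝ}
    (ht : 0 ≤ t) : 0 ≤ γ t := (hs.nonneg_and_pos hh h0 ht).1

lemma pos (hs : M.IsState γ₀ h γ) (hh : M.Admissible h) (h0 : 0 ≤ γ₀) (h1 : 0 < γ₀ ∨ M.σ₂ ≠ 0)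
    {t : ℝ} (ht : 0 < t) : 0 < γ t :=
  (hs.nonneg_and_pos hh h0 ht.le).2 (h1.imp_right fun h => ⟨h, ht⟩)

lemma le_γmax (hs : M.IsState γ₀ h γ) (hM : M.Standing) (hh : M.Admissible h)
    (h0 : γ₀ ≤ M.γmax) {t : ℝ} (ht : 0 ≤ t) : γ t ≤ M.γmax := by
  have hac : AbsolutelyContinuousOnInterval (fun t => M.γmax - γ t) 0 t :=
    (contDiff_const.contDiffOn.absolutelyContinuousOnInterval).fun_sub
      (hs.absolutelyContinuousOnInterval hh le_rfl ht)
  have key := (nonneg_and_pos_of_ae_hasDerivAt ht hac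
    (g := fun t => -M.f (γ t) (h t))
    -- With this `B`, `-f γ h + B (γmax - γ) = h γ² - f γmax 0`, which is nonnegative.
    (B := fun t => (1 / M.σ₁) ^ 2 * (γ (max t 0) + M.γmax) + 2 * M.lam) (k := 0)
    (by filter_upwards [hs.ae_hasDerivAt hh] with s h1 h2 using (h1 h2.1).const_sub _)
    (((hs.continuous_max.add continuous_const).const_mul _).add continuous_const) le_rfl ?_ (by simp [hs.zero, h0])).1
  · linarith
  · intro s hs'
    have h1 := (hh.2 s hs'.1.le).1
    have h2 := hM.f_γmax_neg le_rfl
    simp only [max_eq_left hs'.1.le, f] at h2 ⊢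
    nlinarith [mul_nonneg h1 (sq_nonneg (γ s))]

lemma mem_Icc (hs : M.IsState γ₀ h γ) (hM : M.Standing) (hh : M.Admissible h)
    (h0 : γ₀ ∈ Icc 0 M.γmax) {t : ℝ} (ht : 0 ≤ t) : γ t ∈ Icc 0 M.γmax :=
  ⟨hs.nonneg hh h0.1 ht, hs.le_γmax hM hh h0.2 ht⟩

end IsState

end Model

/-! ### The verification inequality -/

namespace Model

variable {M : Model} {γ₀ : ℝ} {h γ γs q : ℝ → ℝ}

/-- The rate given by the maximum principle. -/
noncomputable def extRate (M : Model) (γ q : ℝ → ℝ) (t : ℝ) : ℝ := M.rate (γ t ^ 2 * q t)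

/-- The discounted running cost. -/
noncomputable def running (M : Model) (h γ : ℝ → ℝ) (t : ℝ) : ℝ :=
  Real.exp (-M.δ * t) * (M.abar * γ t + M.c (h t))

/-- The excess of the running cost over that of an extremal, which is not compensated by the
derivative of `boundary`. -/
noncomputable def excess (M : Model) (γs q h γ : ℝ → ℝ) (t : ℝ) : ℝ :=
  M.abar * (γ t - γs t) ^ 2 * (γ t)⁻¹ +
    (M.c (h t) - M.c (M.extRate γs q t) - γs t ^ 2 * q t * (h t - M.extRate γs q t))

/-- The discounted product of the costate of the precision with the difference of the
precisions. -/
noncomputable def boundary (M : Model) (γs q γ : ℝ → ℝ) (t : ℝ) : ℝ :=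
  Real.exp (-M.δ * t) * (q t * (γs t * γs t * (γ t)⁻¹ - γs t))

namespace IsExtremal

lemma price_mem (hE : M.IsExtremal γs q) (hM : M.Standing) {t : ℝ} (ht : 0 ≤ t) :
    γs t ^ 2 * q t ∈ Icc 0 M.M₀ :=
  hM.price_mem (y := (γs t, q t)) ⟨hE.γ_mem t ht, hE.q_mem t ht⟩

lemma continuousOn_γ (hE : M.IsExtremal γs q) : ContinuousOn γs (Ici 0) := fun t ht =>
  (hE.γ_deriv t ht).continuousWithinAt

lemma continuousOn_q (hE : M.IsExtremal γs q) : ContinuousOn q (Ici 0) := fun t ht =>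
  (hE.q_deriv t ht).continuousWithinAt

lemma continuousOn_extRate (hE : M.IsExtremal γs q) (hM : M.Standing) :
    ContinuousOn (M.extRate γs q) (Ici 0) :=
  hM.continuousOn_rate.comp ((hE.continuousOn_γ.pow 2).mul hE.continuousOn_q) fun _ ht =>
    (hE.price_mem hM ht).2

lemma admissible (hE : M.IsExtremal γs q) (hM : M.Standing) :
    M.Admissible (M.extRate γs q) :=
  ⟨(hE.continuousOn_extRate hM).domRestrict.measurable, fun _ ht =>
    ⟨Standing.rate_nonneg M _, hM.rate_le_hmax (hE.price_mem hM ht).2⟩⟩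

lemma isState (hE : M.IsExtremal γs q) (hM : M.Standing) :
    M.IsState (γs 0) (M.extRate γs q) γs := by
  refine ⟨hE.continuousOn_γ, fun t ht => ?_⟩
  have hsub : Icc 0 t ⊆ Ici (0 : ℝ) := fun s hs => hs.1
  have hc1 := hE.continuousOn_γ.mono hsub
  have hc2 := (hE.continuousOn_extRate hM).mono hsub
  have := intervalIntegral.integral_eq_sub_of_hasDerivAt_of_le ht
    (f := γs) (f' := fun s => M.f (γs s) (M.extRate γs q s)) hc1
    (fun s hs => (hE.γ_deriv s hs.1.le).hasDerivAt (Ici_mem_nhds hs.1)) ?_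
  · rw [this]; ring
  · refine ContinuousOn.intervalIntegrable_of_Icc ht ?_
    unfold f
    fun_prop

lemma absolutelyContinuousOnInterval_q (hE : M.IsExtremal γs q) (hM : M.Standing) {a b : ℝ}
    (ha : 0 ≤ a) (hb : 0 ≤ b) : AbsolutelyContinuousOnInterval q a b := by
  have hsub := uIcc_subset_Ici ha hb
  have hc1 := hE.continuousOn_γ.mono hsub
  have hc2 := (hE.continuousOn_extRate hM).mono hsub
  have hc3 := hE.continuousOn_q.mono hsub
  obtain ⟨C, hC⟩ := (isCompact_uIcc (a := a) (b := b)).exists_bound_of_continuousOn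
    (f := fun s => M.adj (γs s) (M.extRate γs q s) (q s)) (by unfold adj; fun_prop)
  have := (convex_uIcc a b).lipschitzOnWith_of_nnnorm_hasDerivWithin_le (C := C.toNNReal) (f := q)
    (fun s hs => (hE.q_deriv s (hsub hs)).mono hsub)
    (fun s hs => by
      rw [← NNReal.coe_le_coe, coe_nnnorm]
      exact (hC s hs).trans (Real.le_coe_toNNReal C))
  exact this.absolutelyContinuousOnInterval

lemma shift (hE : M.IsExtremal γs q) {s : ℝ} (hs : 0 ≤ s) :
    M.IsExtremal (fun t => γs (t + s)) (fun t => q (t + s)) := by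
  have hm : MapsTo (fun t => t + s) (Ici 0) (Ici (0 : ℝ)) := fun t ht => add_nonneg ht hs
  have hd : ∀ t, HasDerivWithinAt (fun t => t + s) 1 (Ici 0) t := fun t =>
    (hasDerivWithinAt_id t _).add_const s
  refine ⟨fun t ht => hE.γ_mem _ (hm ht), fun t ht => hE.q_mem _ (hm ht), fun t ht => ?_,
    fun t ht => ?_⟩
  · simpa [Function.comp_def] using (hE.γ_deriv _ (hm ht)).scomp t (hd t) hm
  · simpa [Function.comp_def] using (hE.q_deriv _ (hm ht)).scomp t (hd t) hm

end IsExtremal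

namespace IsState

lemma aestronglyMeasurable_cost (hM : M.Standing) (hh : M.Admissible h) :
    AEStronglyMeasurable (fun t => M.c (h t)) (volume.restrict (Ici 0)) := by
  have hc : Continuous fun x => M.c (max x 0) :=
    hM.c_smooth.continuousOn.comp_continuous (by fun_prop) fun x => le_max_right x 0
  refine (hc.comp_aestronglyMeasurable hh.aestronglyMeasurable).congr ?_
  refine (ae_restrict_iff' measurableSet_Ici).2 (Eventually.of_forall fun t ht => ?_)
  simp [max_eq_left (hh.2 t ht).1]

lemma cost_mem (hM : M.Standing) (hh : M.Admissible h) {t : ℝ} (ht : 0 ≤ t) :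
    M.c (h t) ∈ Icc 0 (M.c M.hmax) :=
  ⟨hM.c_nonneg _ (hh.2 t ht).1, hM.c_mono.monotoneOn (hh.2 t ht).1
    (Standing.hmax_nonneg M : 0 ≤ M.hmax) (hh.2 t ht).2⟩

lemma intervalIntegrable_cost (hM : M.Standing) (hh : M.Admissible h) {a b : ℝ} (ha : 0 ≤ a)
    (hb : 0 ≤ b) : IntervalIntegrable (fun t => M.c (h t)) volume a b := by
  rw [intervalIntegrable_iff]
  have : IsFiniteMeasure (volume.restrict (uIoc a b)) := by rw [uIoc]; infer_instance
  refine Integrable.of_bound ((aestronglyMeasurable_cost hM hh).mono_set (uIoc_subset_Ici ha hb))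
    (M.c M.hmax) ?_
  refine (ae_restrict_iff' measurableSet_uIoc).2 (Eventually.of_forall fun t ht => ?_)
  have := cost_mem hM hh (uIoc_subset_Ici ha hb ht)
  rw [Real.norm_eq_abs, abs_of_nonneg this.1]
  exact this.2

lemma integrableOn_running (hs : M.IsState γ₀ h γ) (hM : M.Standing) (hh : M.Admissible h)
    (h0 : γ₀ ∈ Icc 0 M.γmax) : IntegrableOn (M.running h γ) (Ioi 0) := by
  have h1 : IntegrableOn (fun t => Real.exp (-M.δ * t) * (M.abar * M.γmax + M.c M.hmax)) (Ioi 0) :=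
    (exp_neg_integrableOn_Ioi 0 hM.δ_pos).mul_const _
  have hsub : volume.restrict (Ioi (0 : ℝ)) ≤ volume.restrict (Ici 0) :=
    Measure.restrict_mono Ioi_subset_Ici_self le_rfl
  have hγ : AEStronglyMeasurable γ (volume.restrict (Ici 0)) :=
    hs.1.aestronglyMeasurable measurableSet_Ici
  refine Integrable.mono' h1 ?_ ?_
  · refine AEStronglyMeasurable.mono_measure ?_ hsub
    have he : AEStronglyMeasurable (fun t => Real.exp (-M.δ * t)) (volume.restrict (Ici 0)) :=
      (by fun_prop : Continuous fun t => Real.exp (-M.δ * t)).aestronglyMeasurable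
    exact he.mul ((hγ.const_mul _).add (aestronglyMeasurable_cost hM hh))
  · refine (ae_restrict_iff' measurableSet_Ioi).2 (Eventually.of_forall fun t ht => ?_)
    have ht' : (0 : ℝ) ≤ t := le_of_lt ht
    have h2 := hs.mem_Icc hM hh h0 ht'
    have h3 := cost_mem hM hh ht'
    have h4 := hM.abar_pos
    unfold running
    rw [Real.norm_eq_abs, abs_of_nonneg
      (mul_nonneg (Real.exp_pos _).le (add_nonneg (mul_nonneg h4.le h2.1) h3.1))]
    gcongr
    exacts [h2.2, h3.2]

lemma intervalIntegrable_running (hs : M.IsState γ₀ h γ) (hM : M.Standing) (hh : M.Admissible h)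
    {a b : ℝ} (ha : 0 ≤ a) (hb : 0 ≤ b) : IntervalIntegrable (M.running h γ) volume a b := by
  have hc := hs.1.mono (uIcc_subset_Ici ha hb)
  refine IntervalIntegrable.continuousOn_mul (IntervalIntegrable.add ?_
    (intervalIntegrable_cost hM hh ha hb)) (by fun_prop)
  exact ContinuousOn.intervalIntegrable (by fun_prop)

end IsState

lemma excess_nonneg (hM : M.Standing) (hE : M.IsExtremal γs q) (hh : M.Admissible h) {t : ℝ}
    (ht : 0 ≤ t) (hγ : 0 ≤ γ t) : 0 ≤ M.excess γs q h γ t := by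
  have h1 := hM.cost_gap_nonneg (hE.price_mem hM ht).2 (hh.2 t ht).1
  have h2 := hM.abar_pos
  exact add_nonneg (by positivity) h1

lemma intervalIntegrable_excess (hM : M.Standing) (hE : M.IsExtremal γs q)
    (hs : M.IsState γ₀ h γ) (hh : M.Admissible h) {a b : ℝ} (ha : 0 ≤ a) (hb : 0 ≤ b)
    (hpos : ∀ t ∈ uIcc a b, γ t ≠ 0) :
    IntervalIntegrable (fun t => Real.exp (-M.δ * t) * M.excess γs q h γ t) volume a b := by
  have hsub := uIcc_subset_Ici ha hb
  have hc := hs.1.mono hsub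
  have hc1 := hE.continuousOn_γ.mono hsub
  have hc2 := (hE.continuousOn_extRate hM).mono hsub
  have hc3 := hE.continuousOn_q.mono hsub
  have hc4 := hc.inv₀ hpos
  refine IntervalIntegrable.continuousOn_mul ?_ (by fun_prop)
  refine IntervalIntegrable.add (ContinuousOn.intervalIntegrable (by fun_prop)) ?_
  refine IntervalIntegrable.sub (IntervalIntegrable.sub
    (IsState.intervalIntegrable_cost hM hh ha hb)
    (IsState.intervalIntegrable_cost hM (hE.admissible hM) ha hb)) ?_
  exact ((hh.intervalIntegrable ha hb).sub hc2.intervalIntegrable).continuousOn_mul (by fun_prop)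

/-- The verification inequality in differential form, with the derivative of the product of the
costate of the precision with the difference of the precisions in place of that of `boundary`. -/
lemma running_sub_running_ge {abar α lam σ δ c cs g gs hh hs q : ℝ} (hg : 0 < g)
    (hq : 0 ≤ q) :
    ((δ + 2 * lam + 2 * (α + hs) * gs) * q - abar) * (gs * gs * g⁻¹ - gs) +
      q * ((2 * gs * g⁻¹ - 1) * (-(α + hs) * gs ^ 2 - 2 * lam * gs + σ ^ 2) +
        gs * gs * (-(-(α + hh) * g ^ 2 - 2 * lam * g + σ ^ 2) / g ^ 2)) -
      δ * (q * (gs * gs * g⁻¹ - gs)) +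
      (abar * (g - gs) ^ 2 * g⁻¹ + (c - cs - gs ^ 2 * q * (hh - hs)))
      ≤ (abar * g + c) - (abar * gs + cs) := by
  have key : (abar * g + c) - (abar * gs + cs) -
      (((δ + 2 * lam + 2 * (α + hs) * gs) * q - abar) * (gs * gs * g⁻¹ - gs) +
      q * ((2 * gs * g⁻¹ - 1) * (-(α + hs) * gs ^ 2 - 2 * lam * gs + σ ^ 2) +
        gs * gs * (-(-(α + hh) * g ^ 2 - 2 * lam * g + σ ^ 2) / g ^ 2)) -
      δ * (q * (gs * gs * g⁻¹ - gs)) +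
      (abar * (g - gs) ^ 2 * g⁻¹ + (c - cs - gs ^ 2 * q * (hh - hs))))
      -- The slack is the concavity gap `σ² (1 / g - 1 / gs) ^ 2` of the precision drift, weighted
      -- with the price `gs ^ 2 * q`. The convexity gap of `abar / x` is the first term of the
      -- excess.
      = q * (σ * (gs - g) / g) ^ 2 := by
    field_simp
    ring
  have : 0 ≤ q * (σ * (gs - g) / g) ^ 2 := by positivity
  linarith

/-- On an interval where `γ` is positive, its inverse is absolutely continuous, so `boundary` is the
integral of its derivative and `running_sub_running_ge` can be integrated. -/
lemma boundary_add_integral_excess_le (hM : M.Standing) (hE : M.IsExtremal γs q)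
    (hs : M.IsState γ₀ h γ) (hh : M.Admissible h) {a b : ℝ} (ha : 0 < a) (hab : a ≤ b)
    (hpos : ∀ t ∈ Icc a b, 0 < γ t) :
    M.boundary γs q γ b - M.boundary γs q γ a +
      ∫ t in a..b, Real.exp (-M.δ * t) * M.excess γs q h γ t ≤
    ∫ t in a..b, (M.running h γ t - M.running (M.extRate γs q) γs t) := by
  have hb : 0 ≤ b := ha.le.trans hab
  have hu : uIcc a b = Icc a b := uIcc_of_le hab
  have hss := hE.isState hM
  have hsa := hE.admissible hM
  obtain ⟨x, hx, hmin⟩ := isCompact_Icc.exists_isMinOn (nonempty_Icc.2 hab)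
    (hs.1.mono (fun t ht => ha.le.trans ht.1 : Icc a b ⊆ Ici 0))
  have hinv : AbsolutelyContinuousOnInterval (fun t => (γ t)⁻¹) a b :=
    (hs.absolutelyContinuousOnInterval hh ha.le hb).inv_of_le (hpos x hx) fun t ht =>
      hmin (hu ▸ ht)
  have hγs := hss.absolutelyContinuousOnInterval hsa ha.le hb
  have hexp : AbsolutelyContinuousOnInterval (fun t => Real.exp (-M.δ * t)) a b :=
    (by fun_prop : ContDiff ℝ 1 fun t => Real.exp (-M.δ * t)).contDiffOn.absolutelyContinuousOnInterval
  have hac : AbsolutelyContinuousOnInterval (M.boundary γs q γ) a b :=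
    hexp.fun_mul ((hE.absolutelyContinuousOnInterval_q hM ha.le hb).fun_mul
      (((hγs.fun_mul hγs).fun_mul hinv).fun_sub hγs))
  let D : ℝ → ℝ := fun t =>
    M.adj (γs t) (M.extRate γs q t) (q t) * (γs t * γs t * (γ t)⁻¹ - γs t) +
      q t * ((2 * γs t * (γ t)⁻¹ - 1) * M.f (γs t) (M.extRate γs q t) +
        γs t * γs t * (-M.f (γ t) (h t) / γ t ^ 2)) -
      M.δ * (q t * (γs t * γs t * (γ t)⁻¹ - γs t))
  have hd : ∀ᵐ t, t ∈ Ioo a b →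
      HasDerivAt (M.boundary γs q γ) (Real.exp (-M.δ * t) * D t) t := by
    filter_upwards [hs.ae_hasDerivAt hh] with t ht hmem
    have ht0 : 0 < t := ha.trans hmem.1
    have hne := (hpos t ⟨hmem.1.le, hmem.2.le⟩).ne'
    have d1 := (ht ht0).inv hne
    have d2 := (hE.γ_deriv t ht0.le).hasDerivAt (Ici_mem_nhds ht0)
    have d3 := (hE.q_deriv t ht0.le).hasDerivAt (Ici_mem_nhds ht0)
    have d4 : HasDerivAt (fun t => Real.exp (-M.δ * t)) (Real.exp (-M.δ * t) * (-M.δ)) t := by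
      simpa using ((hasDerivAt_id t).const_mul (-M.δ)).exp
    refine (d4.mul (d3.mul (((d2.mul d2).mul d1).sub d2))).congr_deriv ?_
    simp only [D, extRate, Pi.mul_apply, Pi.sub_apply, Pi.inv_apply]
    ring
  obtain ⟨hDint, hDeq⟩ := hac.integral_eq_sub_of_ae_hasDerivAt hab hd
  have hRint := intervalIntegrable_excess hM hE hs hh ha.le hb
    (fun t ht => (hpos t (hu ▸ ht)).ne')
  rw [← hDeq, ← intervalIntegral.integral_add hDint hRint]
  refine intervalIntegral.integral_mono_on hab (hDint.add hRint)
    ((hs.intervalIntegrable_running hM hh ha.le hb).sub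
      (hss.intervalIntegrable_running hM hsa ha.le hb)) fun t ht => ?_
  rw [← mul_add]
  unfold running
  rw [← mul_sub]
  refine mul_le_mul_of_nonneg_left ?_ (Real.exp_pos _).le
  exact running_sub_running_ge (hpos t ht) (hE.q_mem t (ha.le.trans ht.1)).1

/-- Extremals are optimal, and they give subgradients of the value with respect to the precision. -/
lemma cost_add_integral_excess_le (hM : M.Standing) (hE : M.IsExtremal γs q)
    (hs : M.IsState γ₀ h γ) (hh : M.Admissible h) (h0 : γ₀ ∈ Icc 0 M.γmax)
    (hpos : ∀ t, 0 < t → 0 < γ t) {φ : ℝ}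
    (hφ : Tendsto (M.boundary γs q γ) (𝓝[>] 0) (𝓝 φ)) {a b : ℝ} (ha : 0 < a) (hab : a ≤ b) :
    M.cost (M.extRate γs q) γs - φ + ∫ t in a..b, Real.exp (-M.δ * t) * M.excess γs q h γ t ≤
      M.cost h γ := by
  have hss := hE.isState hM
  have hsa := hE.admissible hM
  have hi1 := hs.integrableOn_running hM hh h0
  have hi2 := hss.integrableOn_running hM hsa (hE.γ_mem 0 le_rfl)
  set L : ℝ → ℝ := fun t => M.running h γ t - M.running (M.extRate γs q) γs t with hL
  have hLint : IntegrableOn L (Ioi 0) := hi1.sub hi2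
  have hLii : ∀ {a b : ℝ}, 0 ≤ a → 0 ≤ b → IntervalIntegrable L volume a b := fun ha hb =>
    (hs.intervalIntegrable_running hM hh ha hb).sub (hss.intervalIntegrable_running hM hsa ha hb)
  have hcost : ∫ t in Ioi (0 : ℝ), L t = M.cost h γ - M.cost (M.extRate γs q) γs :=
    integral_sub hi1 hi2
  set I := ∫ t in a..b, Real.exp (-M.δ * t) * M.excess γs q h γ t
  set C := M.abar / M.δ * M.γmax
  -- The comparison starts at `ε > 0` because `1 / γ` is unbounded near `0` if `γ₀ = 0`. Then `T →
  -- ∞` and `ε → 0`.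
  have step : ∀ ε, 0 < ε → ε ≤ a → ∀ T, b ≤ T →
      -(C * Real.exp (-M.δ * T)) - M.boundary γs q γ ε + I + (∫ t in (0 : ℝ)..ε, L t) ≤
        ∫ t in (0 : ℝ)..T, L t := by
    intro ε hε hεa T hT
    have hεT : ε ≤ T := hεa.trans (hab.trans hT)
    have hT0 : 0 ≤ T := hε.le.trans hεT
    have h1 := boundary_add_integral_excess_le hM hE hs hh hε hεT fun t ht =>
      hpos t (hε.trans_le ht.1)
    have h2 : I ≤ ∫ t in ε..T, Real.exp (-M.δ * t) * M.excess γs q h γ t := by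
      refine intervalIntegral.integral_mono_interval hεa hab hT ?_
        (intervalIntegrable_excess hM hE hs hh hε.le hT0 fun t ht => ?_)
      · refine (ae_restrict_iff' measurableSet_Ioc).2 (Eventually.of_forall fun t ht => ?_)
        have ht0 : 0 < t := hε.trans ht.1
        exact mul_nonneg (Real.exp_pos _).le (excess_nonneg hM hE hh ht0.le (hpos t ht0).le)
      · rw [uIcc_of_le hεT] at ht
        exact (hpos t (hε.trans_le ht.1)).ne'
    -- Only the negative part `-q γs` is estimated. The other term contains `1 / γ`, which has no a
    -- priori bound, but it has the favourable sign.
    have h3 : -(C * Real.exp (-M.δ * T)) ≤ M.boundary γs q γ T := by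
      obtain ⟨g1, g2⟩ := hE.γ_mem T hT0
      obtain ⟨q1, q2⟩ := hE.q_mem T hT0
      have h4 : q T * γs T ≤ C := mul_le_mul q2 g2 g1 (q1.trans q2)
      have h5 : 0 ≤ q T * (γs T * γs T * (γ T)⁻¹) := by
        have := hpos T (hε.trans_le hεT)
        positivity
      unfold boundary
      nlinarith [Real.exp_pos (-M.δ * T)]
    have h6 := intervalIntegral.integral_add_adjacent_intervals (hLii le_rfl hε.le)
      (hLii hε.le hT0)
    linarith
  have step2 : ∀ ε, 0 < ε → ε ≤ a → - M.boundary γs q γ ε + I + (∫ t in (0 : ℝ)..ε, L t) ≤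
      M.cost h γ - M.cost (M.extRate γs q) γs := by
    intro ε hε hεa
    rw [← hcost]
    have t1 : Tendsto (fun T => ∫ t in (0 : ℝ)..T, L t) atTop (𝓝 (∫ t in Ioi (0 : ℝ), L t)) :=
      intervalIntegral_tendsto_integral_Ioi 0 hLint tendsto_id
    have t2 : Tendsto (fun T => -(C * Real.exp (-M.δ * T)) - M.boundary γs q γ ε + I +
        (∫ t in (0 : ℝ)..ε, L t)) atTop
        (𝓝 (-(C * 0) - M.boundary γs q γ ε + I + (∫ t in (0 : ℝ)..ε, L t))) := by
      have : Tendsto (fun T => Real.exp (-M.δ * T)) atTop (𝓝 0) :=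
        Real.tendsto_exp_atBot.comp (tendsto_id.const_mul_atTop_of_neg (by linarith [hM.δ_pos]))
      exact (((this.const_mul C).neg.sub_const _).add_const _).add_const _
    rw [mul_zero, neg_zero, zero_sub] at t2
    refine le_of_tendsto_of_tendsto t2 t1 ?_
    filter_upwards [eventually_ge_atTop b] with T hT using step ε hε hεa T hT
  have t3 : Tendsto (fun ε => ∫ t in (0 : ℝ)..ε, L t) (𝓝[>] 0) (𝓝 0) := by
    have hc : ContinuousOn (fun ε => ∫ t in (0 : ℝ)..ε, L t) (uIcc 0 1) :=
      intervalIntegral.continuousOn_primitive_interval' (hLii le_rfl zero_le_one) left_mem_uIcc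
    have := hc 0 left_mem_uIcc
    rw [ContinuousWithinAt, intervalIntegral.integral_same, uIcc_of_le zero_le_one] at this
    refine this.mono_left ?_
    rw [← nhdsWithin_Ioo_eq_nhdsGT (zero_lt_one (α := ℝ))]
    exact nhdsWithin_mono 0 Ioo_subset_Icc_self
  have t4 := (hφ.neg.add_const I).add t3
  have h7 : -φ + I + 0 ≤ M.cost h γ - M.cost (M.extRate γs q) γs := by
    refine le_of_tendsto t4 ?_
    filter_upwards [Ioc_mem_nhdsGT ha] with ε hε using step2 ε hε.1 hε.2
  linarith

end Model

/-! ### Optimality and uniqueness of extremals -/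

namespace Model

variable {M : Model} {γ₀ : ℝ} {h γ γs q : ℝ → ℝ}

lemma tendsto_boundary_of_pos (hE : M.IsExtremal γs q) (hs : M.IsState γ₀ h γ) (h0 : 0 < γ₀) :
    Tendsto (M.boundary γs q γ) (𝓝[>] 0) (𝓝 (q 0 * (γs 0 * γs 0 * γ₀⁻¹ - γs 0))) := by
  have hmono : 𝓝[>] (0 : ℝ) ≤ 𝓝[≥] 0 := nhdsWithin_mono _ Ioi_subset_Ici_self
  have h1 : Tendsto γs (𝓝[>] 0) (𝓝 (γs 0)) := (hE.continuousOn_γ 0 self_mem_Ici).mono_left hmono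
  have h2 : Tendsto q (𝓝[>] 0) (𝓝 (q 0)) := (hE.continuousOn_q 0 self_mem_Ici).mono_left hmono
  have h3 : Tendsto γ (𝓝[>] 0) (𝓝 γ₀) := by
    have : Tendsto γ (𝓝[≥] 0) (𝓝 (γ 0)) := hs.1 0 self_mem_Ici
    rw [hs.zero] at this
    exact this.mono_left hmono
  have h4 : Tendsto (fun t => Real.exp (-M.δ * t)) (𝓝[>] 0) (𝓝 1) := by
    have : Continuous fun t => Real.exp (-M.δ * t) := by fun_prop
    simpa using (this.tendsto 0).mono_left nhdsWithin_le_nhds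
  have := h4.mul (h2.mul (((h1.mul h1).mul (h3.inv₀ h0.ne')).sub h1))
  rwa [one_mul] at this

lemma IsState.le_mul (hs : M.IsState 0 h γ) (hM : M.Standing) (hh : M.Admissible h) {t : ℝ}
    (ht : 0 ≤ t) : γ t ≤ M.σ₂ ^ 2 * t := by
  have h1 := hs.2 t ht
  have h2 : ∫ s in (0 : ℝ)..t, M.f (γ s) (h s) ≤ ∫ s in (0 : ℝ)..t, M.σ₂ ^ 2 := by
    refine intervalIntegral.integral_mono_on ht (hs.intervalIntegrable hh le_rfl ht)
      (by simp) fun s hs' => ?_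
    have h3 := hs.nonneg hh le_rfl hs'.1
    have h4 := (hh.2 s hs'.1).1
    have h5 := hM.lam_nonneg
    have h6 : 0 ≤ ((1 / M.σ₁) ^ 2 + h s) * γ s ^ 2 + 2 * M.lam * γ s := by positivity
    unfold f
    linarith
  rw [intervalIntegral.integral_const, smul_eq_mul] at h2
  linarith

/-- As the state tends to `0` the drift tends to `σ₂²`, uniformly over rates in `[0, hmax]`, so it
soon exceeds half of that. -/
lemma IsState.eventually_mul_le (hs : M.IsState 0 h γ) (hh : M.Admissible h) (hσ : M.σ₂ ≠ 0) :
    ∀ᶠ t in 𝓝[>] (0 : ℝ), M.σ₂ ^ 2 / 2 * t ≤ γ t := by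
  have hσ2 : 0 < M.σ₂ ^ 2 := by positivity
  have hlim : Tendsto (fun t => ((1 / M.σ₁) ^ 2 + M.hmax) * γ t ^ 2 + 2 * M.lam * γ t)
      (𝓝[≥] 0) (𝓝 0) := by
    have h1 : Tendsto γ (𝓝[≥] 0) (𝓝 (γ 0)) := hs.1 0 self_mem_Ici
    rw [hs.zero] at h1
    have h2 := ((h1.pow 2).const_mul ((1 / M.σ₁) ^ 2 + M.hmax)).add (h1.const_mul (2 * M.lam))
    rwa [zero_pow two_ne_zero, mul_zero, mul_zero, add_zero] at h2
  have h2 := hlim.eventually (gt_mem_nhds (half_pos hσ2))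
  obtain ⟨ε, hε, hεs⟩ := mem_nhdsGE_iff_exists_Ico_subset.1 h2
  filter_upwards [Ioo_mem_nhdsGT hε] with t ht
  rw [hs.2 t ht.1.le, zero_add]
  have h3 : ∫ s in (0 : ℝ)..t, M.σ₂ ^ 2 / 2 ≤ ∫ s in (0 : ℝ)..t, M.f (γ s) (h s) := by
    refine intervalIntegral.integral_mono_on ht.1.le (by simp)
      (hs.intervalIntegrable hh le_rfl ht.1.le) fun s hs' => ?_
    have h4 := hεs ⟨hs'.1, hs'.2.trans_lt ht.2⟩
    have h5 := (hh.2 s hs'.1).2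
    simp only [mem_ofPred_eq] at h4
    unfold f
    nlinarith [mul_nonneg (sub_nonneg.2 h5) (sq_nonneg (γ s))]
  rw [intervalIntegral.integral_const, smul_eq_mul] at h3
  linarith

/-- Both states grow linearly from `0`, so `γs / γ` stays bounded (by `2`) and `γs² / γ` vanishes
with `γs`, although both precisions are infinite at time `0`. -/
lemma tendsto_boundary_of_zero (hM : M.Standing) (hE : M.IsExtremal γs q) (h0 : γs 0 = 0)
    (hs : M.IsState 0 h γ) (hh : M.Admissible h) (hσ : M.σ₂ ≠ 0) :
    Tendsto (M.boundary γs q γ) (𝓝[>] 0) (𝓝 0) := by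
  have hss := hE.isState hM
  rw [h0] at hss
  have hsa := hE.admissible hM
  have hσ2 : 0 < M.σ₂ ^ 2 := by positivity
  have hQ : 0 ≤ M.abar / M.δ := (div_pos hM.abar_pos hM.δ_pos).le
  have hlim : Tendsto (fun t => 3 * (M.abar / M.δ) * (M.σ₂ ^ 2 * t)) (𝓝[>] 0) (𝓝 0) := by
    have : Continuous fun t => 3 * (M.abar / M.δ) * (M.σ₂ ^ 2 * t) := by fun_prop
    simpa using (this.tendsto 0).mono_left nhdsWithin_le_nhds
  refine squeeze_zero_norm' ?_ hlim
  filter_upwards [hs.eventually_mul_le hh hσ, self_mem_nhdsWithin] with t h1 h2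
  have ht : (0 : ℝ) < t := h2
  have h3 := hss.le_mul hM hsa ht.le
  have h5 : 0 < γ t := (by positivity : (0 : ℝ) < M.σ₂ ^ 2 / 2 * t).trans_le h1
  obtain ⟨g1, g2⟩ := hE.γ_mem t ht.le
  obtain ⟨q1, q2⟩ := hE.q_mem t ht.le
  have h6 : γs t * (γ t)⁻¹ ≤ 2 := by
    rw [← div_eq_mul_inv, div_le_iff₀ h5]
    linarith
  have h7 : 0 ≤ γs t * (γ t)⁻¹ := by positivity
  have h8 : |γs t * γs t * (γ t)⁻¹ - γs t| ≤ 3 * γs t := by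
    rw [abs_le]
    constructor <;> nlinarith
  have h9 : Real.exp (-M.δ * t) ≤ 1 := by
    rw [Real.exp_le_one_iff]
    nlinarith [hM.δ_pos]
  unfold boundary
  rw [Real.norm_eq_abs, abs_mul, abs_mul, abs_of_pos (Real.exp_pos _), abs_of_nonneg q1]
  calc _ ≤ 1 * (M.abar / M.δ * (3 * γs t)) := by gcongr
    _ ≤ 1 * (M.abar / M.δ * (3 * (M.σ₂ ^ 2 * t))) := by gcongr
    _ = _ := by ring

lemma IsState.eq_zero (hs : M.IsState 0 h γ) (hM : M.Standing) (hh : M.Admissible h)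
    (hσ : M.σ₂ = 0) {t : ℝ} (ht : 0 ≤ t) : γ t = 0 := by
  have := hs.le_mul hM hh ht
  rw [hσ] at this
  exact le_antisymm (by linarith) (hs.nonneg hh le_rfl ht)

/-- An extremal is optimal, with a quantitative estimate. -/
lemma cost_add_integral_excess_le_of_eq (hM : M.Standing) (hE : M.IsExtremal γs q)
    (hs : M.IsState (γs 0) h γ) (hh : M.Admissible h) {a b : ℝ} (ha : 0 < a) (hab : a ≤ b) :
    M.cost (M.extRate γs q) γs + ∫ t in a..b, Real.exp (-M.δ * t) * M.excess γs q h γ t ≤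
      M.cost h γ := by
  have h0 := hE.γ_mem 0 le_rfl
  rcases h0.1.eq_or_lt with h1 | h1
  -- For `γ₀ = 0` and `σ₂ = 0` every state stays `0` and there is no finite precision. The
  -- difference of running costs is then exactly the discounted excess.
  · by_cases hσ : M.σ₂ = 0
    · have hss := hE.isState hM
      have hsa := hE.admissible hM
      rw [← h1] at hss hs
      have hz : M.γmax ∈ Icc 0 M.γmax := right_mem_Icc.2 hM.γmax_pos.le
      have hz0 : (0 : ℝ) ∈ Icc 0 M.γmax := left_mem_Icc.2 hM.γmax_pos.le
      have hi1 := hs.integrableOn_running hM hh hz0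
      have hi2 := hss.integrableOn_running hM hsa hz0
      have hcost : ∫ t in Ioi (0 : ℝ), (M.running h γ t - M.running (M.extRate γs q) γs t) =
        M.cost h γ - M.cost (M.extRate γs q) γs := integral_sub hi1 hi2
      have heq : EqOn (fun t => M.running h γ t - M.running (M.extRate γs q) γs t)
          (fun t => Real.exp (-M.δ * t) * M.excess γs q h γ t) (Ioi 0) := by
        intro t ht
        have e1 := hs.eq_zero hM hh hσ (le_of_lt ht)
        have e2 := hss.eq_zero hM hsa hσ (le_of_lt ht)
        simp only [running, excess, e1, e2]
        ring
      rw [intervalIntegral.integral_of_le hab]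
      have hmono : ∫ t in Ioc a b, Real.exp (-M.δ * t) * M.excess γs q h γ t ≤
          ∫ t in Ioi (0 : ℝ), Real.exp (-M.δ * t) * M.excess γs q h γ t := by
        refine setIntegral_mono_set ?_ ?_ (Eventually.of_forall fun t ht => ha.trans ht.1)
        · exact (hi1.sub hi2).congr_fun heq measurableSet_Ioi
        · refine (ae_restrict_iff' measurableSet_Ioi).2 (Eventually.of_forall fun t ht => ?_)
          have e1 := hs.nonneg hh le_rfl (le_of_lt ht)
          exact mul_nonneg (Real.exp_pos _).le (excess_nonneg hM hE hh (le_of_lt ht) e1)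
      rw [← setIntegral_congr_fun measurableSet_Ioi heq, hcost] at hmono
      linarith
    · rw [← h1] at hs
      have := cost_add_integral_excess_le hM hE hs hh (left_mem_Icc.2 hM.γmax_pos.le)
        (fun t ht => hs.pos hh le_rfl (Or.inr hσ) ht)
        (tendsto_boundary_of_zero hM hE h1.symm hs hh hσ) ha hab
      rwa [sub_zero] at this
  · have := cost_add_integral_excess_le hM hE hs hh h0
        (fun t ht => hs.pos hh h1.le (Or.inl h1) ht)
        (tendsto_boundary_of_pos hE hs h1) ha hab
    rwa [mul_inv_cancel_right₀ h1.ne', sub_self, mul_zero, sub_zero] at this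

lemma eqOn_Ici_of_ae {u w : ℝ → ℝ} (hu : ContinuousOn u (Ici 0)) (hw : ContinuousOn w (Ici 0))
    (h : ∀ᵐ t, 0 < t → u t = w t) : EqOn u w (Ici 0) := by
  refine Measure.eqOn_of_ae_eq (μ := volume) ?_ hu hw (by simp)
  have hne : ∀ᵐ t : ℝ, t ≠ 0 := by simp [ae_iff, measure_singleton]
  refine (ae_restrict_iff' measurableSet_Ici).2 ?_
  filter_upwards [h, hne] with t h1 h2 h3
  exact h1 (lt_of_le_of_ne h3 h2.symm)

namespace IsExtremal

lemma cost_le (hE : M.IsExtremal γs q) (hM : M.Standing) (hs : M.IsState (γs 0) h γ)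
    (hh : M.Admissible h) : M.cost (M.extRate γs q) γs ≤ M.cost h γ := by
  simpa using cost_add_integral_excess_le_of_eq hM hE hs hh one_pos (le_refl 1)

/-- The optimal control is unique. -/
lemma eqOn_of_cost_eq (hE : M.IsExtremal γs q) (hM : M.Standing) (hs : M.IsState (γs 0) h γ)
    (hh : M.Admissible h) (hc : ContinuousOn h (Ici 0))
    (hcost : M.cost h γ = M.cost (M.extRate γs q) γs) :
    EqOn γ γs (Ici 0) ∧ EqOn h (M.extRate γs q) (Ici 0) := by
  have hss := hE.isState hM
  have hsa := hE.admissible hM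
  have h0 := hE.γ_mem 0 le_rfl
  by_cases hcase : 0 < γs 0 ∨ M.σ₂ ≠ 0
  · have hpos : ∀ t, 0 < t → 0 < γ t := fun t ht => hs.pos hh h0.1 hcase ht
    -- Equal costs force the integral of the nonnegative excess to vanish on every interval; these
    -- intervals exhaust `(0, ∞)`.
    have hex : ∀ᵐ t, ∀ n : ℕ, t ∈ Ioc (1 / ((n : ℝ) + 1)) ((n : ℝ) + 1) →
        Real.exp (-M.δ * t) * M.excess γs q h γ t = 0 := by
      refine ae_all_iff.2 fun n => ?_
      have ha : (0 : ℝ) < 1 / ((n : ℝ) + 1) := by positivity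
      have hab : 1 / ((n : ℝ) + 1) ≤ (n : ℝ) + 1 := by
        have : (1 : ℝ) ≤ (n : ℝ) + 1 := by linarith [n.cast_nonneg (α := ℝ)]
        exact (div_le_one (by linarith)).2 this |>.trans this
      have h1 := cost_add_integral_excess_le_of_eq hM hE hs hh ha hab
      have hnn : 0 ≤ᵐ[volume.restrict (Ioc (1 / ((n : ℝ) + 1)) ((n : ℝ) + 1))]
          fun t => Real.exp (-M.δ * t) * M.excess γs q h γ t := by
        refine (ae_restrict_iff' measurableSet_Ioc).2 (Eventually.of_forall fun t ht => ?_)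
        have ht0 := ha.trans ht.1
        exact mul_nonneg (Real.exp_pos _).le (excess_nonneg hM hE hh ht0.le (hpos t ht0).le)
      have hint := intervalIntegrable_excess hM hE hs hh ha.le (ha.le.trans hab)
        (fun t ht => (hpos t (ha.trans_le (uIcc_of_le hab ▸ ht).1)).ne')
      have h2 : ∫ t in (1 / ((n : ℝ) + 1))..((n : ℝ) + 1),
          Real.exp (-M.δ * t) * M.excess γs q h γ t = 0 := by
        refine le_antisymm (by linarith) ?_
        rw [intervalIntegral.integral_of_le hab]
        exact integral_nonneg_of_ae hnn
      rw [intervalIntegral.integral_eq_zero_iff_of_le_of_nonneg_ae hab hnn hint] at h2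
      exact (ae_restrict_iff' measurableSet_Ioc).1 h2
    have hex' : ∀ᵐ t, 0 < t → γ t = γs t ∧ h t = M.extRate γs q t := by
      filter_upwards [hex] with t ht ht0
      obtain ⟨n, hn⟩ := exists_nat_gt (max t (1 / t))
      have hn1 : t < n := (le_max_left _ _).trans_lt hn
      have hn2 : 1 / t < n := (le_max_right _ _).trans_lt hn
      have h3 : 1 / ((n : ℝ) + 1) < t := by
        rw [div_lt_iff₀ ht0] at hn2
        rw [div_lt_iff₀ (by positivity)]
        nlinarith
      have h4 := (mul_eq_zero.1 (ht n ⟨h3, by linarith⟩)).resolve_left (Real.exp_pos _).ne'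
      have h5 := hM.cost_gap_nonneg (hE.price_mem hM ht0.le).2 (hh.2 t ht0.le).1
      have h6 := hM.abar_pos
      have h7 := hpos t ht0
      have h8 : 0 ≤ M.abar * (γ t - γs t) ^ 2 * (γ t)⁻¹ := by positivity
      unfold excess extRate at h4
      constructor
      · have h9 : M.abar * (γ t - γs t) ^ 2 * (γ t)⁻¹ = 0 := by linarith
        have : γ t - γs t = 0 := by simpa [h6.ne', h7.ne'] using h9
        linarith
      · by_contra hne
        have := hM.cost_gap_pos (hE.price_mem hM ht0.le).2 (hh.2 t ht0.le).1 hne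
        linarith
    exact ⟨eqOn_Ici_of_ae hs.1 hss.1 (by filter_upwards [hex'] with t h1 h2 using (h1 h2).1),
      eqOn_Ici_of_ae hc (hE.continuousOn_extRate hM)
        (by filter_upwards [hex'] with t h1 h2 using (h1 h2).2)⟩
  -- In the degenerate case the state is `0` for every rate, and strict monotonicity of `c` makes
  -- the zero rate the only continuous optimum.
  · push Not at hcase
    obtain ⟨hz, hσ⟩ := hcase
    have hz' : γs 0 = 0 := le_antisymm hz h0.1
    have hz0 : (0 : ℝ) ∈ Icc 0 M.γmax := left_mem_Icc.2 hM.γmax_pos.le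
    rw [hz'] at hs hss
    have e1 : ∀ t, 0 ≤ t → γ t = 0 := fun t => hs.eq_zero hM hh hσ
    have e2 : ∀ t, 0 ≤ t → γs t = 0 := fun t => hss.eq_zero hM hsa hσ
    have e3 : ∀ t, 0 ≤ t → M.extRate γs q t = 0 := fun t ht => by
      unfold extRate
      rw [e2 t ht]
      exact hM.rate_eq_zero (by simpa using hM.M₀_pos.le) (by simpa using hM.c'_nonneg 0)
    refine ⟨fun t ht => (e1 t ht).trans (e2 t ht).symm, ?_⟩
    have hi1 := hs.integrableOn_running hM hh hz0
    have hi2 := hss.integrableOn_running hM hsa hz0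
    have hint : ∫ t in Ioi (0 : ℝ), (M.running h γ t - M.running (M.extRate γs q) γs t) = 0 := by
      rw [integral_sub hi1 hi2, sub_eq_zero]
      exact hcost
    have hform : ∀ t, 0 < t → M.running h γ t - M.running (M.extRate γs q) γs t =
        Real.exp (-M.δ * t) * (M.c (h t) - M.c 0) := fun t ht => by
      unfold running
      rw [e1 t ht.le, e2 t ht.le, e3 t ht.le]
      ring
    have hnn : 0 ≤ᵐ[volume.restrict (Ioi 0)]
        fun t => M.running h γ t - M.running (M.extRate γs q) γs t := by
      refine (ae_restrict_iff' measurableSet_Ioi).2 (Eventually.of_forall fun t ht => ?_)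
      have ht' : (0 : ℝ) ≤ t := le_of_lt ht
      simp only [Pi.zero_apply]
      rw [hform t ht]
      have := hM.c_mono.monotoneOn (self_mem_Ici (a := (0 : ℝ))) (hh.2 t ht').1 (hh.2 t ht').1
      exact mul_nonneg (Real.exp_pos _).le (by linarith)
    rw [integral_eq_zero_iff_of_nonneg_ae hnn (hi1.sub hi2)] at hint
    refine eqOn_Ici_of_ae hc (hE.continuousOn_extRate hM) ?_
    filter_upwards [(ae_restrict_iff' measurableSet_Ioi).1 hint] with t ht ht0
    have h1 := ht ht0
    simp only [Pi.zero_apply] at h1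
    rw [hform t ht0] at h1
    have h2 := (mul_eq_zero.1 h1).resolve_left (Real.exp_pos _).ne'
    rw [e3 t ht0.le]
    exact hM.c_mono.injOn (hh.2 t ht0.le).1 (self_mem_Ici (a := (0 : ℝ))) (sub_eq_zero.1 h2)

lemma value_eq (hE : M.IsExtremal γs q) (hM : M.Standing) :
    M.value (γs 0) = M.cost (M.extRate γs q) γs := by
  refine IsLeast.csInf_eq ⟨⟨_, _, hE.admissible hM, hE.isState hM, rfl⟩, ?_⟩
  rintro J ⟨h, γ, hh, hs, rfl⟩
  exact hE.cost_le hM hs hh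

lemma isOptimal (hE : M.IsExtremal γs q) (hM : M.Standing) :
    M.IsOptimal (γs 0) (M.extRate γs q) γs :=
  ⟨hE.admissible hM, hE.continuousOn_extRate hM, hE.isState hM, (hE.value_eq hM).symm⟩

lemma eqOn_of_isOptimal (hE : M.IsExtremal γs q) (hM : M.Standing)
    (ho : M.IsOptimal (γs 0) h γ) : EqOn γ γs (Ici 0) ∧ EqOn h (M.extRate γs q) (Ici 0) :=
  hE.eqOn_of_cost_eq hM ho.state ho.admissible ho.continuousOn
    (ho.optimal.trans (hE.value_eq hM))

/-- An extremal is determined by its initial state. -/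
lemma eqOn (hE : M.IsExtremal γs q) (hM : M.Standing) {γ' q' : ℝ → ℝ}
    (hE' : M.IsExtremal γ' q') (h0 : γ' 0 = γs 0) : EqOn γ' γs (Ici 0) ∧ EqOn q' q (Ici 0) := by
  have ho := hE'.isOptimal hM
  rw [h0] at ho
  obtain ⟨hγ, hr⟩ := hE.eqOn_of_isOptimal hM ho
  refine ⟨hγ, ?_⟩
  -- With equal states and rates the costate equations are linear with the same growth rate, at
  -- least `δ`. Hence `u` is nondecreasing, while boundedness of the costates makes it tend to `0`.
  set u : ℝ → ℝ := fun t => Real.exp (-2 * M.δ * t) * (q' t - q t) ^ 2 with hu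
  have hδ := hM.δ_pos
  have hd : ∀ t, 0 ≤ t → ∃ d, 0 ≤ d ∧ HasDerivWithinAt u d (Ici 0) t := by
    intro t ht
    have e1 : M.rate (γ' t ^ 2 * q' t) = M.rate (γs t ^ 2 * q t) := hr ht
    have d1 := hE'.q_deriv t ht
    rw [e1, hγ ht] at d1
    have d2 : HasDerivWithinAt (fun t => Real.exp (-2 * M.δ * t))
        (Real.exp (-2 * M.δ * t) * (-2 * M.δ)) (Ici 0) t := by
      simpa using ((hasDerivAt_id t).const_mul (-2 * M.δ)).exp.hasDerivWithinAt
    refine ⟨_, ?_, d2.mul ((d1.sub (hE.q_deriv t ht)).pow 2)⟩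
    have h1 := (hE.γ_mem t ht).1
    have h2 := Standing.rate_nonneg M (γs t ^ 2 * q t)
    have h3 := hM.lam_nonneg
    set A := 2 * M.lam + 2 * ((1 / M.σ₁) ^ 2 + M.rate (γs t ^ 2 * q t)) * γs t with hA
    have h4 : 0 ≤ A := by positivity
    have e2 : M.adj (γs t) (M.rate (γs t ^ 2 * q t)) (q' t) -
        M.adj (γs t) (M.rate (γs t ^ 2 * q t)) (q t) = (M.δ + A) * (q' t - q t) := by
      rw [hA]; unfold adj; ring
    have h5 : 0 ≤ Real.exp (-2 * M.δ * t) * (2 * A * (q' t - q t) ^ 2) := by positivity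
    rw [e2]
    simp only [Pi.sub_apply]
    refine h5.trans (le_of_eq ?_)
    push_cast
    ring
  have hc : ContinuousOn u (Ici 0) := fun t ht => (hd t ht).choose_spec.2.continuousWithinAt
  have hmono : MonotoneOn u (Ici 0) := by
    choose! d hd0 hd1 using hd
    exact monotoneOn_of_hasDerivWithinAt_nonneg (convex_Ici 0) hc
      (fun t ht => (hd1 t (interior_subset ht)).mono interior_subset)
      fun t ht => hd0 t (interior_subset ht)
  set C := M.abar / M.δ
  have hlim : Tendsto (fun t => Real.exp (-2 * M.δ * t) * C ^ 2) atTop (𝓝 0) := by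
    have : Tendsto (fun T => Real.exp (-2 * M.δ * T)) atTop (𝓝 0) :=
      Real.tendsto_exp_atBot.comp (tendsto_id.const_mul_atTop_of_neg (by linarith))
    simpa using this.mul_const (C ^ 2)
  intro t ht
  have h1 : u t ≤ 0 := by
    refine ge_of_tendsto hlim ?_
    filter_upwards [eventually_ge_atTop t] with s hs
    have hs0 : (0 : ℝ) ≤ s := le_trans ht hs
    refine (hmono ht hs0 hs).trans ?_
    obtain ⟨a1, a2⟩ := hE.q_mem s hs0
    obtain ⟨b1, b2⟩ := hE'.q_mem s hs0
    refine mul_le_mul_of_nonneg_left ?_ (Real.exp_pos _).le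
    exact sq_le_sq' (by linarith) (by linarith)
  have h2 : (q' t - q t) ^ 2 ≤ 0 := by
    by_contra! h
    exact absurd (mul_pos (Real.exp_pos (-2 * M.δ * t)) h) (not_lt.2 h1)
  have := pow_eq_zero_iff (two_ne_zero) |>.1 (le_antisymm h2 (sq_nonneg _))
  linarith

/-- The strict subgradient inequality for the value as a function of the precision. -/
lemma value_lt (hE : M.IsExtremal γs q) (hM : M.Standing) {γ' q' : ℝ → ℝ}
    (hE' : M.IsExtremal γ' q') (h0 : 0 < γ' 0) (hne : γ' 0 ≠ γs 0) :
    M.value (γs 0) - q 0 * (γs 0 * γs 0 * (γ' 0)⁻¹ - γs 0) < M.value (γ' 0) := by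
  have hs := hE'.isState hM
  have hh := hE'.admissible hM
  have hpos : ∀ t, 0 < t → 0 < γ' t := fun t ht => hs.pos hh h0.le (Or.inl h0) ht
  -- The states still differ shortly after time `0`, so the quadratic term makes the excess strictly
  -- positive there.
  have hev : ∀ᶠ t in 𝓝[≥] (0 : ℝ), γ' t - γs t ≠ 0 :=
    ((hE'.continuousOn_γ 0 self_mem_Ici).sub (hE.continuousOn_γ 0 self_mem_Ici)).eventually_ne
      (sub_ne_zero.2 hne)
  obtain ⟨b, hb, hbs⟩ := mem_nhdsGE_iff_exists_Ico_subset.1 hev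
  have hb' : (0 : ℝ) < b := hb
  have ha : (0 : ℝ) < b / 2 := by linarith
  have hab : b / 2 < b := by linarith
  have key := cost_add_integral_excess_le hM hE hs hh (hE'.γ_mem 0 le_rfl) hpos
    (tendsto_boundary_of_pos hE hs h0) ha hab.le
  rw [← hE.value_eq hM, ← hE'.value_eq hM] at key
  have hI : 0 < ∫ t in (b / 2)..b,
      Real.exp (-M.δ * t) * M.excess γs q (M.extRate γ' q') γ' t := by
    refine intervalIntegral.intervalIntegral_pos_of_pos_on
      (intervalIntegrable_excess hM hE hs hh ha.le hb'.le fun t ht =>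
        (hpos t (ha.trans_le (uIcc_of_le hab.le ▸ ht).1)).ne') (fun t ht => ?_) hab
    have ht0 : 0 < t := ha.trans ht.1
    have h1 : γ' t - γs t ≠ 0 := hbs ⟨ht0.le, ht.2⟩
    have h2 := hM.cost_gap_nonneg (hE.price_mem hM ht0.le).2 (hh.2 t ht0.le).1
    have h3 := hM.abar_pos
    have h4 := hpos t ht0
    exact mul_pos (Real.exp_pos _) (add_pos_of_pos_of_nonneg (by positivity) h2)
  linarith

end IsExtremal

end Model

/-! ### Shifts and limits at infinity -/

/-- A continuous function on `[0, ∞)` whose shifts all compare with it as their initial values do is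
monotone. -/
lemma monotoneOn_or_antitoneOn_of_shift {u : ℝ → ℝ} (hc : ContinuousOn u (Ici 0))
    (hge : ∀ s, 0 ≤ s → u 0 ≤ u s → ∀ t, 0 ≤ t → u t ≤ u (t + s))
    (hle : ∀ s, 0 ≤ s → u s ≤ u 0 → ∀ t, 0 ≤ t → u (t + s) ≤ u t) :
    MonotoneOn u (Ici 0) ∨ AntitoneOn u (Ici 0) := by
  by_cases hall : ∀ s, 0 ≤ s → u s ≤ u 0
  · right
    intro a ha b hb hab
    have := hle (b - a) (by linarith) (hall _ (by linarith)) a ha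
    rwa [add_sub_cancel] at this
  left
  push Not at hall
  obtain ⟨s, hs, hus⟩ := hall
  -- If half of a time had a value at most `u 0`, applying that shift twice would give the same for
  -- the whole time. So all dyadic shifts are upward, and multiples of them approximate every
  -- increment.
  have hdy : ∀ n : ℕ, u 0 < u (s / 2 ^ n) := by
    intro n
    induction n with
    | zero => simpa using hus
    | succ n ih =>
      by_contra! h
      have h0 : 0 ≤ s / 2 ^ (n + 1) := by positivity
      have h1 := hle _ h0 h _ h0
      have e : s / 2 ^ (n + 1) + s / 2 ^ (n + 1) = s / 2 ^ n := by rw [pow_succ]; ring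
      rw [e] at h1
      linarith
  have hmul : ∀ (n k : ℕ) (t : ℝ), 0 ≤ t → u t ≤ u (t + k * (s / 2 ^ n)) := by
    intro n k t ht
    induction k with
    | zero => simp
    | succ k ih =>
      have h0 : 0 ≤ s / 2 ^ n := by positivity
      have h1 := hge _ h0 (hdy n).le (t + k * (s / 2 ^ n)) (by positivity)
      have e : t + k * (s / 2 ^ n) + s / 2 ^ n = t + ((k + 1 : ℕ) : ℝ) * (s / 2 ^ n) := by
        push_cast; ring
      rw [e] at h1
      exact ih.trans h1
  have hs0 : 0 < s := by
    rcases hs.eq_or_lt with h | h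
    · rw [← h] at hus
      exact absurd hus (lt_irrefl _)
    · exact h
  intro a ha b hb hab
  have ha' : (0 : ℝ) ≤ a := ha
  have hlim1 : Tendsto (fun n : ℕ => s / 2 ^ n) atTop (𝓝 0) := by
    have := (tendsto_pow_atTop_nhds_zero_of_lt_one (r := (1 / 2 : ℝ)) (by norm_num)
      (by norm_num)).const_mul s
    simpa [div_eq_mul_inv] using this
  have hlow : ∀ n : ℕ, b - a - s / 2 ^ n ≤ ⌊(b - a) / (s / 2 ^ n)⌋₊ * (s / 2 ^ n) := by
    intro n
    have h0 : 0 < s / 2 ^ n := by positivity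
    have h1 := Nat.lt_floor_add_one ((b - a) / (s / 2 ^ n))
    rw [div_lt_iff₀ h0] at h1
    linarith
  have hup : ∀ n : ℕ, ⌊(b - a) / (s / 2 ^ n)⌋₊ * (s / 2 ^ n) ≤ b - a := by
    intro n
    have h0 : 0 < s / 2 ^ n := by positivity
    have h1 := Nat.floor_le (div_nonneg (sub_nonneg.2 hab) h0.le)
    rwa [le_div_iff₀ h0] at h1
  have hlim2 : Tendsto (fun n : ℕ => a + ⌊(b - a) / (s / 2 ^ n)⌋₊ * (s / 2 ^ n)) atTop (𝓝 b) := by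
    have h1 : Tendsto (fun n : ℕ => b - a - s / 2 ^ n) atTop (𝓝 (b - a)) := by
      simpa using hlim1.const_sub (b - a)
    have := (tendsto_of_tendsto_of_tendsto_of_le_of_le h1 tendsto_const_nhds hlow hup).const_add a
    rwa [add_sub_cancel] at this
  refine ge_of_tendsto ((hc b hb).tendsto.comp (tendsto_nhdsWithin_iff.2 ⟨hlim2, ?_⟩))
    (Eventually.of_forall fun n => hmul n _ a ha)
  exact Eventually.of_forall fun n => add_nonneg ha' (by positivity)

/-- If a function and its derivative both converge at infinity, the derivative converges to `0`. -/
lemma eq_zero_of_tendsto_deriv {u u' : ℝ → ℝ} {a b : ℝ}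
    (hd : ∀ t, 0 ≤ t → HasDerivWithinAt u (u' t) (Ici 0) t)
    (hu : Tendsto u atTop (𝓝 a)) (hu' : Tendsto u' atTop (𝓝 b)) : b = 0 := by
  -- The mean value theorem on `[t, t + 1]` gives points going to infinity where the derivative
  -- equals an increment that tends to `0`.
  have hex : ∀ t : ℝ, ∃ x, 0 ≤ t → t < x ∧ u' x = u (t + 1) - u t := by
    intro t
    by_cases ht : 0 ≤ t
    · obtain ⟨x, hx, hx'⟩ := exists_hasDerivAt_eq_slope u u' (show t < t + 1 by linarith)
        (fun s hs => ((hd s (ht.trans hs.1)).continuousWithinAt).mono fun r hr => ht.trans hr.1)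
        (fun s hs => (hd s (ht.trans hs.1.le)).hasDerivAt (Ici_mem_nhds (ht.trans_lt hs.1)))
      exact ⟨x, fun _ => ⟨hx.1, by simpa using hx'⟩⟩
    · exact ⟨0, fun h => absurd h ht⟩
  choose x hx using hex
  have h1 : Tendsto x atTop atTop := by
    refine tendsto_atTop_mono' _ ?_ tendsto_id
    filter_upwards [eventually_ge_atTop (0 : ℝ)] with t ht using (hx t ht).1.le
  have h2 : Tendsto (fun t => u (t + 1) - u t) atTop (𝓝 (a - a)) :=
    (hu.comp (tendsto_atTop_add_const_right _ 1 tendsto_id)).sub hu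
  rw [sub_self] at h2
  refine tendsto_nhds_unique ((hu'.comp h1).congr' ?_) h2
  filter_upwards [eventually_ge_atTop (0 : ℝ)] with t ht using (hx t ht).2

/-! ### The feedback law: costate and price as functions of the state -/

namespace Model

variable {M : Model}

/-- The initial costate of the extremals that start at `x`. -/
noncomputable def costate (M : Model) (x : ℝ) : ℝ :=
  Classical.epsilon fun z => ∃ γ q, M.IsExtremal γ q ∧ γ 0 = x ∧ q 0 = z

/-- The shadow price of the precision, as a function of the conditional variance. -/
noncomputable def price (M : Model) (x : ℝ) : ℝ := x ^ 2 * M.costate x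

namespace IsExtremal

variable {γ q γ' q' : ℝ → ℝ}

/-- Uniqueness of extremals makes the choice in `costate` irrelevant. By shifting time, the costate
is then a function of the state along the whole extremal. -/
lemma costate_zero (hE : M.IsExtremal γ q) (hM : M.Standing) : M.costate (γ 0) = q 0 := by
  obtain ⟨γ', q', hE', h1, h2⟩ := Classical.epsilon_spec
    (p := fun z => ∃ γ' q', M.IsExtremal γ' q' ∧ γ' 0 = γ 0 ∧ q' 0 = z) ⟨q 0, γ, q, hE, rfl, rfl⟩
  exact h2.symm.trans ((hE.eqOn hM hE' h1).2 self_mem_Ici)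

lemma costate_eq (hE : M.IsExtremal γ q) (hM : M.Standing) {t : ℝ} (ht : 0 ≤ t) :
    M.costate (γ t) = q t := by
  simpa using (hE.shift ht).costate_zero hM

lemma extRate_eq (hE : M.IsExtremal γ q) (hM : M.Standing) {t : ℝ} (ht : 0 ≤ t) :
    M.extRate γ q t = M.rate (M.price (γ t)) := by
  rw [extRate, price, hE.costate_eq hM ht]

/-- Extremals do not cross. -/
lemma le_of_le (hE : M.IsExtremal γ q) (hM : M.Standing) (hE' : M.IsExtremal γ' q')
    (h0 : γ 0 ≤ γ' 0) {t : ℝ} (ht : 0 ≤ t) : γ t ≤ γ' t := by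
  by_contra! hlt
  have hsub : Icc 0 t ⊆ Ici (0 : ℝ) := fun s hs => hs.1
  obtain ⟨s, hs, hs0⟩ := intermediate_value_Icc ht
    (f := fun s => γ s - γ' s)
    ((hE.continuousOn_γ.mono hsub).sub (hE'.continuousOn_γ.mono hsub))
    (show (0 : ℝ) ∈ Icc _ _ from ⟨by linarith, by linarith⟩)
  -- From a common value at time `s` on, the two extremals coincide, which contradicts their order
  -- at time `t`.
  have h1 := ((hE'.shift hs.1).eqOn hM (hE.shift hs.1)
    (by simpa using sub_eq_zero.1 hs0)).1 (show t - s ∈ Ici (0 : ℝ) from sub_nonneg.2 hs.2)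
  simp only [sub_add_cancel] at h1
  linarith

/-- The system is autonomous, so time shifts of an extremal are extremals, and they cannot cross it.
-/
lemma monotoneOn_or_antitoneOn (hE : M.IsExtremal γ q) (hM : M.Standing) :
    MonotoneOn γ (Ici 0) ∨ AntitoneOn γ (Ici 0) :=
  monotoneOn_or_antitoneOn_of_shift hE.continuousOn_γ
    (fun _ hs h _ ht => hE.le_of_le hM (hE.shift hs) (by simpa using h) ht)
    (fun _ hs h _ ht => (hE.shift hs).le_of_le hM hE (by simpa using h) ht)

end IsExtremal

namespace Standing

lemma costate_mem (hM : M.Standing) {x : ℝ} (hx : x ∈ Icc 0 M.γmax) :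
    M.costate x ∈ Icc 0 (M.abar / M.δ) := by
  obtain ⟨γ, q, hE, rfl⟩ := hM.exists_isExtremal hx
  rw [hE.costate_zero hM]
  exact hE.q_mem 0 le_rfl

lemma price_mem_Icc (hM : M.Standing) {x : ℝ} (hx : x ∈ Icc 0 M.γmax) :
    M.price x ∈ Icc 0 M.M₀ :=
  hM.price_mem (y := (x, M.costate x)) ⟨hx, hM.costate_mem hx⟩

/-- Compactness and uniqueness: extremals from converging initial states accumulate at an extremal
from the limit state, and its initial costate is the only possible accumulation point. -/
lemma continuousOn_costate (hM : M.Standing) : ContinuousOn M.costate (Icc 0 M.γmax) := by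
  intro x hx
  refine tendsto_of_seq_tendsto fun u hu => ?_
  rw [tendsto_nhdsWithin_iff] at hu
  by_contra hnot
  rw [Metric.tendsto_atTop'] at hnot
  push Not at hnot
  obtain ⟨ε, hε, hfar⟩ := hnot
  have hfreq : ∃ᶠ n in atTop, u n ∈ Icc 0 M.γmax ∧ ε ≤ dist (M.costate (u n)) (M.costate x) := by
    have : ∃ᶠ n in atTop, ε ≤ dist (M.costate (u n)) (M.costate x) := by
      rw [frequently_atTop]
      intro N
      obtain ⟨n, hn, hn'⟩ := hfar N
      exact ⟨n, hn.le, hn'⟩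
    exact (hu.2.and_frequently this)
  obtain ⟨φ, hφ, hφ'⟩ := extraction_of_frequently_atTop hfreq
  choose γ q hE hγ0 using fun n => hM.exists_isExtremal (hφ' n).1
  obtain ⟨γ', q', hE', h0, U, hU, hlim⟩ := hM.exists_isExtremal_of_tendsto hE (γ₀ := x) (by
    simpa only [hγ0] using! hu.1.comp hφ.tendsto_atTop)
  have h1 : ∀ n, q n 0 = M.costate (u (φ n)) := fun n => by
    rw [← (hE n).costate_zero hM, hγ0]
  rw [← hE'.costate_zero hM, h0] at hlim
  simp only [h1] at hlim
  have h2 := (hlim.eventually (Metric.ball_mem_nhds _ hε)).exists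
  obtain ⟨n, hn⟩ := h2
  exact absurd hn (not_lt.2 (hφ' n).2)

lemma continuousOn_price (hM : M.Standing) : ContinuousOn M.price (Icc 0 M.γmax) := by
  have := hM.continuousOn_costate
  unfold price
  fun_prop

/-- The strict subgradient inequality for `v (1 / x)`, rewritten in the variance. Used with `x` and
`y` interchanged as well, it bounds difference quotients of `v` on both sides. -/
lemma value_sub_lt (hM : M.Standing) {x y : ℝ} (hx : x ∈ Icc 0 M.γmax) (hy : y ∈ Ioc 0 M.γmax)
    (hne : y ≠ x) : M.costate x * x / y * (y - x) < M.value y - M.value x := by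
  obtain ⟨γ, q, hE, rfl⟩ := hM.exists_isExtremal hx
  obtain ⟨γ', q', hE', rfl⟩ := hM.exists_isExtremal ⟨hy.1.le, hy.2⟩
  have h1 := hE.value_lt hM hE' hy.1 hne
  rw [hE.costate_zero hM]
  have hy0 := hy.1.ne'
  have e : q 0 * γ 0 / γ' 0 * (γ' 0 - γ 0) = -(q 0 * (γ 0 * γ 0 * (γ' 0)⁻¹ - γ 0)) := by
    field_simp
    ring
  linarith

/-- Adding the subgradient inequalities at two points shows that the subgradient `-price` of the
strictly convex value is strictly increasing in the precision. -/
lemma strictMonoOn_price (hM : M.Standing) : StrictMonoOn M.price (Ioc 0 M.γmax) := by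
  intro x hx y hy hxy
  have h1 := hM.value_sub_lt ⟨hx.1.le, hx.2⟩ hy hxy.ne'
  have h2 := hM.value_sub_lt ⟨hy.1.le, hy.2⟩ hx hxy.ne
  have hx0 := hx.1
  have hy0 := hy.1
  have h3 : M.costate x * x / y < M.costate y * y / x := by
    have : 0 < (y - x) * (M.costate y * y / x - M.costate x * x / y) := by linarith
    have := pos_of_mul_pos_right this (by linarith)
    linarith
  rw [div_lt_div_iff₀ hy0 hx0] at h3
  unfold price
  linarith

lemma monotoneOn_price (hM : M.Standing) : MonotoneOn M.price (Icc 0 M.γmax) := by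
  intro x hx y hy hxy
  rcases hx.1.eq_or_lt with h | h
  · rw [← h]
    simpa [price] using (hM.price_mem_Icc hy).1
  · exact hM.strictMonoOn_price.monotoneOn ⟨h, hx.2⟩ ⟨h.trans_le hxy, hy.2⟩ hxy

/-- The costate is the derivative of the value function. -/
lemma hasDerivWithinAt_value (hM : M.Standing) {x : ℝ} (hx : x ∈ Ioc 0 M.γmax) :
    HasDerivWithinAt M.value (M.costate x) (Icc 0 M.γmax) x := by
  have hx' : x ∈ Icc 0 M.γmax := ⟨hx.1.le, hx.2⟩
  have hx0 := hx.1
  have hQ : Tendsto M.costate (𝓝[Icc 0 M.γmax] x) (𝓝 (M.costate x)) := hM.continuousOn_costate x hx'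
  have hid : Tendsto (fun y => y) (𝓝[Icc 0 M.γmax] x) (𝓝 x) := nhdsWithin_le_nhds
  have hA : Tendsto (fun y => |M.costate x * x / y - M.costate x| +
      |M.costate y * y / x - M.costate x|) (𝓝[Icc 0 M.γmax] x) (𝓝 0) := by
    have h1 : Tendsto (fun y => M.costate x * x / y) (𝓝[Icc 0 M.γmax] x) (𝓝 (M.costate x * x / x)) :=
      tendsto_const_nhds.div hid hx0.ne'
    have h2 : Tendsto (fun y => M.costate y * y / x) (𝓝[Icc 0 M.γmax] x) (𝓝 (M.costate x * x / x)) :=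
      (hQ.mul hid).div_const x
    rw [mul_div_cancel_right₀ _ hx0.ne'] at h1 h2
    simpa using (h1.sub_const (M.costate x)).abs.add (h2.sub_const (M.costate x)).abs
  rw [hasDerivWithinAt_iff_isLittleO, Asymptotics.isLittleO_iff]
  intro ε hε
  filter_upwards [hA.eventually (gt_mem_nhds hε), self_mem_nhdsWithin,
    hid.eventually (lt_mem_nhds hx0)] with y h1 hy hy0
  by_cases hne : y = x
  · simp [hne]
  have h2 := hM.value_sub_lt hx' ⟨hy0, hy.2⟩ hne
  have h3 := hM.value_sub_lt hy hx (Ne.symm hne)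
  rw [smul_eq_mul, Real.norm_eq_abs, Real.norm_eq_abs]
  set A := M.costate x * x / y
  set B := M.costate y * y / x
  have h4 : -(|A - M.costate x| * |y - x|) ≤ (A - M.costate x) * (y - x) := by
    rw [← abs_mul]; exact neg_abs_le _
  have h5 : (B - M.costate x) * (y - x) ≤ |B - M.costate x| * |y - x| := by
    rw [← abs_mul]; exact le_abs_self _
  have h6 : (|A - M.costate x| + |B - M.costate x|) * |y - x| ≤ ε * |y - x| :=
    mul_le_mul_of_nonneg_right h1.le (abs_nonneg _)
  have h7 : 0 ≤ |A - M.costate x| * |y - x| := by positivity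
  have h8 : 0 ≤ |B - M.costate x| * |y - x| := by positivity
  rw [abs_le]
  constructor <;> nlinarith

lemma value'_eq (hM : M.Standing) {x : ℝ} (hx : x ∈ Ioc 0 M.γmax) :
    M.value' x = M.costate x :=
  (hM.hasDerivWithinAt_value hx).derivWithin
    (uniqueDiffOn_Icc hM.γmax_pos x ⟨hx.1.le, hx.2⟩)

/-- At `x = 0` the factor `x ^ 2` removes the value of `value'`, whose identification with the
costate is only established for positive states. -/
lemma sq_mul_value' (hM : M.Standing) {x : ℝ} (hx : x ∈ Icc 0 M.γmax) :
    x ^ 2 * M.value' x = M.price x := by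
  rcases hx.1.eq_or_lt with h | h
  · simp [← h, price]
  · rw [hM.value'_eq ⟨h, hx.2⟩, price]

/-- Information is acquired exactly above the threshold. -/
lemma rate_price (hM : M.Standing) {x : ℝ} (hx : x ∈ Icc 0 M.γmax) :
    (x ≤ M.γD → M.rate (M.price x) = 0) ∧ (M.γD < x → 0 < M.rate (M.price x)) := by
  have hp := (hM.price_mem_Icc hx).2
  by_cases hD : ∃ γ, γ ∈ Icc 0 M.γmax ∧ γ ^ 2 * M.value' γ = M.c' 0
  · have hDe : M.γD = hD.choose := dif_pos hD
    obtain ⟨h1, h2⟩ := hD.choose_spec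
    rw [← hDe] at h1 h2
    rw [hM.sq_mul_value' h1] at h2
    refine ⟨fun h => hM.rate_eq_zero hp (h2 ▸ hM.monotoneOn_price hx h1 h), fun h => ?_⟩
    refine hM.rate_pos hp (h2 ▸ ?_)
    -- Strict monotonicity of the price is known only on `(0, γmax]`, and `γD` may be `0`; the
    -- midpoint bridges this.
    have hm : (M.γD + x) / 2 ∈ Ioc 0 M.γmax := ⟨by linarith [h1.1], by linarith [hx.2]⟩
    exact (hM.monotoneOn_price h1 ⟨hm.1.le, hm.2⟩ (by linarith)).trans_lt
      (hM.strictMonoOn_price hm ⟨h1.1.trans_lt h, hx.2⟩ (by linarith))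
  · have hDe : M.γD = M.γmax := dif_neg hD
    rw [hDe]
    refine ⟨fun _ => hM.rate_eq_zero hp ?_, fun h => absurd hx.2 (not_le.2 h)⟩
    by_contra! hlt
    obtain ⟨y, hy, hy'⟩ := intermediate_value_Icc hx.1
      (hM.continuousOn_price.mono (Icc_subset_Icc_right hx.2))
      (show M.c' 0 ∈ Icc (M.price 0) (M.price x) from
        ⟨by simpa [price] using hM.c'_nonneg 0, hlt.le⟩)
    have hyI : y ∈ Icc 0 M.γmax := ⟨hy.1, hy.2.trans hx.2⟩
    exact hD ⟨y, hyI, (hM.sq_mul_value' hyI).trans hy'⟩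

lemma le_of_equilibrium (hM : M.Standing) {x h : ℝ} (hh : 0 ≤ h) (hx : 0 ≤ x)
    (hf : M.f x h = 0) : x ≤ M.σ₁ * M.σ₂ := by
  have h1 := hM.σ₁_pos
  have h2 := hM.σ₂_nonneg
  have h3 := hM.lam_nonneg
  unfold f at hf
  have h4 : (1 / M.σ₁) ^ 2 * x ^ 2 ≤ M.σ₂ ^ 2 := by
    have : 0 ≤ h * x ^ 2 + 2 * M.lam * x := by positivity
    linarith
  rw [← mul_pow] at h4
  have h5 := le_of_sq_le_sq h4 h2
  rwa [one_div, inv_mul_le_iff₀ h1] at h5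

/-- The feedback rate is nondecreasing in the state, so the drift under feedback is strictly
decreasing and has at most one zero. -/
lemma not_lt_of_equilibrium (hM : M.Standing) {x y : ℝ} (hx : x ∈ Icc 0 M.γmax)
    (hy : y ∈ Icc 0 M.γmax) (hfx : M.f x (M.rate (M.price x)) = 0)
    (hfy : M.f y (M.rate (M.price y)) = 0) : ¬ x < y := by
  intro hxy
  have hrx := rate_nonneg M (M.price x)
  have hmono : M.rate (M.price x) ≤ M.rate (M.price y) :=
    hM.monotoneOn_rate (hM.price_mem_Icc hx).2 (hM.price_mem_Icc hy).2
      (hM.monotoneOn_price hx hy hxy.le)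
  have h1 := hM.σ₁_pos
  have h3 := hM.lam_nonneg
  have h4 : 0 < (1 / M.σ₁) ^ 2 := by positivity
  unfold f at hfx hfy
  have h5 : x ^ 2 < y ^ 2 := by nlinarith [hx.1]
  have h6 : ((1 / M.σ₁) ^ 2 + M.rate (M.price x)) * x ^ 2 <
      ((1 / M.σ₁) ^ 2 + M.rate (M.price x)) * y ^ 2 :=
    mul_lt_mul_of_pos_left h5 (by linarith)
  have h7 : ((1 / M.σ₁) ^ 2 + M.rate (M.price x)) * y ^ 2 ≤
      ((1 / M.σ₁) ^ 2 + M.rate (M.price y)) * y ^ 2 :=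
    mul_le_mul_of_nonneg_right (by linarith) (sq_nonneg y)
  nlinarith

/-- There is at most one equilibrium of the optimality system. -/
lemma equilibrium_unique (hM : M.Standing) {x y : ℝ} (hx : x ∈ Icc 0 M.γmax)
    (hy : y ∈ Icc 0 M.γmax) (hfx : M.f x (M.rate (M.price x)) = 0)
    (hfy : M.f y (M.rate (M.price y)) = 0) : x = y :=
  le_antisymm (not_lt.1 (hM.not_lt_of_equilibrium hy hx hfy hfx))
    (not_lt.1 (hM.not_lt_of_equilibrium hx hy hfx hfy))

end Standing

/-- Every extremal converges to an equilibrium. -/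
lemma IsExtremal.exists_tendsto {γ q : ℝ → ℝ} (hE : M.IsExtremal γ q) (hM : M.Standing) :
    ∃ x ∈ Icc 0 M.γmax, Tendsto γ atTop (𝓝 x) ∧
      Tendsto (M.extRate γ q) atTop (𝓝 (M.rate (M.price x))) ∧
      M.f x (M.rate (M.price x)) = 0 := by
  have hev : ∀ᶠ t : ℝ in atTop, 0 ≤ t := eventually_ge_atTop 0
  have hlim : ∃ x, Tendsto γ atTop (𝓝 x) := by
    have hcongr : (fun t => γ (max t 0)) =ᶠ[atTop] γ := by
      filter_upwards [hev] with t ht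
      rw [max_eq_left ht]
    have hmem : ∀ t, γ (max t 0) ∈ Icc 0 M.γmax := fun t => hE.γ_mem _ (le_max_right _ _)
    rcases hE.monotoneOn_or_antitoneOn hM with hmono | hanti
    · have hm : Monotone fun t => γ (max t 0) := fun s t hst =>
        hmono (le_max_right s 0) (le_max_right t 0) (max_le_max_right 0 hst)
      exact ⟨_, (tendsto_atTop_ciSup hm ⟨M.γmax, by rintro _ ⟨t, rfl⟩; exact (hmem t).2⟩).congr'
        hcongr⟩
    · have hm : Antitone fun t => γ (max t 0) := fun s t hst =>
        hanti (le_max_right s 0) (le_max_right t 0) (max_le_max_right 0 hst)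
      exact ⟨_, (tendsto_atTop_ciInf hm ⟨0, by rintro _ ⟨t, rfl⟩; exact (hmem t).1⟩).congr'
        hcongr⟩
  obtain ⟨x, hx⟩ := hlim
  have hxI : x ∈ Icc 0 M.γmax := isClosed_Icc.mem_of_tendsto hx (hev.mono fun t ht => hE.γ_mem t ht)
  have hp : Tendsto (fun t => M.price (γ t)) atTop (𝓝 (M.price x)) :=
    (hM.continuousOn_price x hxI).tendsto.comp
      (tendsto_nhdsWithin_iff.2 ⟨hx, hev.mono fun t ht => hE.γ_mem t ht⟩)
  have hr : Tendsto (M.extRate γ q) atTop (𝓝 (M.rate (M.price x))) := by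
    have : Tendsto (fun t => M.rate (M.price (γ t))) atTop (𝓝 (M.rate (M.price x))) :=
      (hM.continuousOn_rate _ (hM.price_mem_Icc hxI).2).tendsto.comp
        (tendsto_nhdsWithin_iff.2 ⟨hp, hev.mono fun t ht => (hM.price_mem_Icc (hE.γ_mem t ht)).2⟩)
    refine this.congr' (hev.mono fun t ht => (hE.extRate_eq hM ht).symm)
  refine ⟨x, hxI, hx, hr, eq_zero_of_tendsto_deriv hE.γ_deriv hx ?_⟩
  unfold f
  exact (((tendsto_const_nhds.add hr).neg.mul (hx.pow 2)).sub (hx.const_mul _)).add_const _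

end Model

/-! ### The equilibrium and the theorem -/

namespace Model

variable {M : Model}

namespace Standing

lemma exists_equilibrium (hM : M.Standing) :
    ∃ x ∈ Icc 0 M.γmax, M.f x (M.rate (M.price x)) = 0 := by
  obtain ⟨γ, q, hE, -⟩ := hM.exists_isExtremal (left_mem_Icc.2 hM.γmax_pos.le)
  obtain ⟨x, hx, -, -, hf⟩ := hE.exists_tendsto hM
  exact ⟨x, hx, hf⟩

lemma optimal_properties (hM : M.Standing) {x γ₀ : ℝ} (hx : x ∈ Icc 0 M.γmax)
    (hf : M.f x (M.rate (M.price x)) = 0) (hγ₀ : γ₀ ∈ Icc 0 M.γmax) {h γ : ℝ → ℝ}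
    (ho : M.IsOptimal γ₀ h γ) :
    Tendsto γ atTop (𝓝 x) ∧ Tendsto h atTop (𝓝 (M.rate (M.price x))) ∧
      (MonotoneOn γ (Ici 0) ∨ AntitoneOn γ (Ici 0)) ∧
      (MonotoneOn h (Ici 0) ∨ AntitoneOn h (Ici 0)) ∧
      ∀ t, 0 ≤ t → (γ t ≤ M.γD → h t = 0) ∧ (M.γD < γ t → 0 < h t) := by
  obtain ⟨γs, q, hE, rfl⟩ := hM.exists_isExtremal hγ₀
  obtain ⟨hγ, hh⟩ := hE.eqOn_of_isOptimal hM ho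
  obtain ⟨y, hy, hty, hthy, hfy⟩ := hE.exists_tendsto hM
  obtain rfl := hM.equilibrium_unique hx hy hf hfy
  have hev : ∀ᶠ t : ℝ in atTop, 0 ≤ t := eventually_ge_atTop 0
  have hrate : EqOn h (fun t => M.rate (M.price (γ t))) (Ici 0) := fun t ht => by
    simp only [hγ ht, hh ht, hE.extRate_eq hM ht]
  have hmem : ∀ t ∈ Ici (0 : ℝ), γ t ∈ Icc 0 M.γmax := fun t ht => hγ ht ▸ hE.γ_mem t ht
  have hmono : MonotoneOn (fun x => M.rate (M.price x)) (Icc 0 M.γmax) :=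
    hM.monotoneOn_rate.comp hM.monotoneOn_price fun x hx => (hM.price_mem_Icc hx).2
  have hcases : MonotoneOn γ (Ici 0) ∨ AntitoneOn γ (Ici 0) :=
    (hE.monotoneOn_or_antitoneOn hM).imp (fun h => h.congr hγ.symm) fun h => h.congr hγ.symm
  refine ⟨hty.congr' (hev.mono fun t ht => (hγ ht).symm),
    hthy.congr' (hev.mono fun t ht => (hh ht).symm), hcases, ?_, fun t ht => ?_⟩
  · exact hcases.imp (fun h => (hmono.comp h hmem).congr hrate.symm)
      fun h => AntitoneOn.congr (fun s hs t ht hst =>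
        hmono (hmem t ht) (hmem s hs) (h hs ht hst)) hrate.symm
  · rw [hrate ht]
    exact hM.rate_price (hmem t ht)

/-- From `√(a² + b²) ≤ a + b` for nonnegative `a`, `b` one gets `γInf ≤ σ₁ s`. Neither `c'` nor `M₀`
involves `σ₂`, so the other assumptions carry over. This keeps the model standing for all small `s`
in the limit (ii). -/
lemma of_σ₂ (hM : M.Standing) {s : ℝ} (hs : 0 ≤ s) (hlt : M.σ₁ * s < M.γmax) :
    ({ M with σ₂ := s } : Model).Standing where
  σ₁_pos := hM.σ₁_pos
  σ₂_nonneg := hs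
  lam_nonneg := hM.lam_nonneg
  δ_pos := hM.δ_pos
  κ_pos := hM.κ_pos
  ρ_pos := hM.ρ_pos
  γInf_lt := by
    refine lt_of_le_of_lt ?_ hlt
    have h1 := hM.σ₁_pos
    have h2 := hM.lam_nonneg
    unfold γInf
    have : Real.sqrt (M.lam ^ 2 * M.σ₁ ^ 4 + M.σ₁ ^ 2 * s ^ 2) ≤ M.σ₁ * s + M.lam * M.σ₁ ^ 2 := by
      refine Real.sqrt_le_iff.2 ⟨by positivity, ?_⟩
      have : 0 ≤ 2 * (M.σ₁ * s) * (M.lam * M.σ₁ ^ 2) := by positivity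
      nlinarith
    linarith
  c_nonneg := hM.c_nonneg
  c_convex := hM.c_convex
  c_smooth := hM.c_smooth
  c_mono := hM.c_mono
  c'_reaches := hM.c'_reaches

end Standing

end Model

theorem mainTheorem7 :
    ∃ γeq heq : Model → ℝ, ∀ M : Model, M.Standing →
      γeq M ∈ Icc 0 M.γmax ∧ heq M ∈ Icc 0 M.hmax ∧
      (∀ γ₀ ∈ Icc 0 M.γmax,
        (∃ h γ : ℝ → ℝ, M.IsOptimal γ₀ h γ) ∧
        ∀ h γ : ℝ → ℝ, M.IsOptimal γ₀ h γ →
          Tendsto γ atTop (𝓝 (γeq M)) ∧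
          Tendsto h atTop (𝓝 (heq M)) ∧
          (MonotoneOn γ (Ici 0) ∨ AntitoneOn γ (Ici 0)) ∧
          (MonotoneOn h (Ici 0) ∨ AntitoneOn h (Ici 0)) ∧
          ∀ t, 0 ≤ t → (γ t ≤ M.γD → h t = 0) ∧ (M.γD < γ t → 0 < h t)) ∧
      Tendsto (fun s : ℝ => γeq { M with σ₂ := s }) (𝓝[≥] 0) (𝓝 0) ∧
      (γeq M = 0 ↔ M.σ₂ = 0) := by
  choose! γeq hmem hf using fun (M : Model) (hM : M.Standing) => hM.exists_equilibrium
  have hle : ∀ M : Model, M.Standing → 0 ≤ γeq M ∧ γeq M ≤ M.σ₁ * M.σ₂ := fun M hM =>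
    ⟨(hmem M hM).1, hM.le_of_equilibrium (Model.Standing.rate_nonneg M _) (hmem M hM).1 (hf M hM)⟩
  refine ⟨γeq, fun M => M.rate (M.price (γeq M)), fun M hM => ⟨hmem M hM,
    ⟨Model.Standing.rate_nonneg M _, hM.rate_le_hmax (hM.price_mem_Icc (hmem M hM)).2⟩,
    fun γ₀ hγ₀ => ⟨?_, fun h γ ho => hM.optimal_properties (hmem M hM) (hf M hM) hγ₀ ho⟩, ?_, ?_⟩⟩
  · obtain ⟨γ, q, hE, rfl⟩ := hM.exists_isExtremal hγ₀
    exact ⟨_, _, hE.isOptimal hM⟩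
  -- The equilibrium is squeezed between `0` and `σ₁ s`.
  · have hlim : Tendsto (fun s : ℝ => M.σ₁ * s) (𝓝[≥] 0) (𝓝 0) := by
      have : Continuous fun s : ℝ => M.σ₁ * s := by fun_prop
      simpa using (this.tendsto 0).mono_left nhdsWithin_le_nhds
    have hev : ∀ᶠ s : ℝ in 𝓝[≥] 0, ({ M with σ₂ := s } : Model).Standing := by
      filter_upwards [hlim.eventually (gt_mem_nhds hM.γmax_pos), self_mem_nhdsWithin] with s h1 h2
      exact hM.of_σ₂ h2 h1
    exact tendsto_of_tendsto_of_tendsto_of_le_of_le' tendsto_const_nhds hlim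
      (hev.mono fun s hs => (hle _ hs).1) (hev.mono fun s hs => (hle _ hs).2)
  · constructor
    -- At `γ = 0` the drift is `σ₂²` whatever the rate, so `0` can be an equilibrium only if `σ₂ =
    -- 0`.
    · intro h0
      have := hf M hM
      rw [h0] at this
      simpa [Model.f] using this
    · intro h0
      have := hle M hM
      rw [h0, mul_zero] at this
      exact le_antisymm this.2 this.1
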